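/- Let $X$ be a complex Banach space. For $\omega>0$ let $S_\omega:=\{z\in\mathbb C:|\operatorname{Im}z|<\omega\}$, and let $\Gamma_\omega:=\partial S_\omega=(i\omega+\mathbb R)\cup(-i\omega+\mathbb R)$ carry arc length measure. A closed linear operator $A$ on $X$ is of strip type $\omega_0\ge 0$ if its spectrum is contained in $\{|\operatorname{Im}z|\le\omega_0\}$ and, for every $\beta>\omega_0$, its resolvent $R(\lambda,A)=(\lambda-A)^{-1}$ is uniformly bounded on $\mathbb C\setminus S_\beta$. For a complex Hilbert space $H$ and a bounded operator $T:H\to X$ let $$\|T\|_\gamma:=\sup_F\Big(\mathbb E\Big\|\sum_{e\in F}\gamma_e\,Te\Big\|^2\Big)^{1/2},$$ where $F$ ranges over the finite orthonormal systems in $H$ and the $\gamma_e$ are independent complex standard Gaussian variables ($\gamma=\gamma_r+i\gamma_i$ with independent real standard Gaussians $\gamma_r,\gamma_i$). Let $\gamma(H;X)$ be the $\|\cdot\|_\gamma$-closure of the finite rank operators in $\{T:\|T\|_\gamma<\infty\}$. A strongly measurable function $u:\Gamma_\omega\to X$ belongs to $\gamma(L^2(\Gamma_\omega);X)$ if it is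 weakly $L^2$ and the operator $J_u:L^2(\Gamma_\omega)\to X$, $J_uh=\int_{\Gamma_\omega}h\,u$ (Pettis integral), lies in $\gamma(L^2(\Gamma_\omega);X)$; then $\|u\|_{\gamma(L^2(\Gamma_\omega);X)}:=\|J_u\|_\gamma$. **Theorem.** Let $A$ be a densely defined operator of strip type $\omega_0\ge0$ on $X$ and let $\omega>\omega_0$. Suppose that for every $x\in X$ the function $\lambda\mapsto R(\lambda,A)x$ belongs to $\gamma(L^2(\Gamma_\omega);X)$ and that there are constants $c,C>0$ with $$c\|x\|\le\|R(\lambda,A)x\|_{\gamma(L^2(\Gamma_\omega);X)}\le C\|x\|\qquad(x\in X).$$ Then $A$ has a bounded $H^\infty(S_\omega)$-calculus, i.e. there is a constant $C'\ge0$ such that $\|f(A)\|\le C'\sup_{z\in S_\omega}|f(z)|$ for every bounded holomorphic $f:S_\omega\to\mathbb C$ with $\int_{\mathbb R}|f(r+is)|\,dr<\infty$ for all $|s|<\omega$, where $$f(A):=\frac1{2\pi i}\int_{\partial S_\delta}f(z)R(z,A)\,dz$$ for any $\delta\in(\omega_0,\omega)$, with $\partial S_\delta$ positively oriented. -/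

import Mathlib

open MeasureTheory ProbabilityTheory Set
open scoped ENNReal

namespace StripCalculus

noncomputable section

/-! ### Resolvents of unbounded operators, operators of strip type -/

section Operators

variable {X : Type*} [NormedAddCommGroup X] [NormedSpace ℂ X]

/-- `R` is a bounded two-sided inverse of `z - A : dom A → X`. -/
def IsResolventAt (A : X →ₗ.[ℂ] X) (z : ℂ) (R : X →L[ℂ] X) : Prop :=
  (∀ y : X, ∃ hy : R y ∈ A.domain, z • R y - A ⟨R y, hy⟩ = y) ∧
    ∀ x : A.domain, R (z • (x : X) - A x) = x

theorem IsResolventAt.unique {A : X →ₗ.[ℂ] X} {z : ℂ} {R S : X →L[ℂ] X}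
    (hR : IsResolventAt A z R) (hS : IsResolventAt A z S) : R = S := by
  ext y
  obtain ⟨hy, e⟩ := hR.1 y
  have h := hS.2 ⟨R y, hy⟩
  simpa [e] using h.symm

/-- The resolvent set of an unbounded operator. -/
def resSet (A : X →ₗ.[ℂ] X) : Set ℂ := {z | ∃ R : X →L[ℂ] X, IsResolventAt A z R}

open Classical in
/-- The resolvent `R(z, A) = (z - A)⁻¹` for `z` in the resolvent set (and `0` elsewhere). -/
def res (A : X →ₗ.[ℂ] X) (z : ℂ) : X →L[ℂ] X :=
  if h : ∃ R : X →L[ℂ] X, IsResolventAt A z R then h.choose else 0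

theorem res_spec {A : X →ₗ.[ℂ] X} {z : ℂ} (hz : z ∈ resSet A) :
    IsResolventAt A z (res A z) := by
  have h : ∃ R : X →L[ℂ] X, IsResolventAt A z R := hz
  rw [res, dif_pos h]
  exact h.choose_spec

/-- The open horizontal strip `{z : |Im z| < ω}` (used for `ω > 0`). -/
def strip (ω : ℝ) : Set ℂ := {z | |z.im| < ω}

/-- `A` is closed, its spectrum lies in the closed strip `{|Im z| ≤ α}`, and for all `β > α` its
resolvent is uniformly bounded outside the open strip of height `β`. -/
structure IsStripType (A : X →ₗ.[ℂ] X) (α : ℝ) : Prop where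
  nonneg : 0 ≤ α
  isClosed : A.IsClosed
  spectrum_subset : (resSet A)ᶜ ⊆ {z : ℂ | |z.im| ≤ α}
  bounded : ∀ β : ℝ, α < β → ∃ M : ℝ, ∀ z : ℂ, z ∉ strip β → ‖res A z‖ ≤ M

end Operators

/-! ### The elementary calculus and bounded `H^∞`-calculus on a strip -/

section Calculus

/-- Elementary functions on the strip of height `ω`: bounded holomorphic functions that are
integrable along each horizontal line in the strip. -/
structure IsElementary (ω : ℝ) (f : ℂ → ℂ) : Prop where
  holo : DifferentiableOn ℂ f (strip ω)
  bdd : BddAbove ((fun z => ‖f z‖) '' strip ω)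
  integrable : ∀ s : ℝ, |s| < ω → Integrable (fun r : ℝ => f (r + s * Complex.I))

/-- The supremum norm of a bounded function on the strip of height `ω`. -/
def hinfNorm (ω : ℝ) (f : ℂ → ℂ) : ℝ := sSup ((fun z => ‖f z‖) '' strip ω)

variable {X : Type*} [NormedAddCommGroup X] [NormedSpace ℂ X]

/-- `(2πi)⁻¹ ∫_{∂ S_δ} f(z) R(z, A) dz`, where the boundary of the strip `S_δ` is positively
oriented: the lower line from left to right, the upper one from right to left. For `A` of strip
type `α`, `f` elementary on `S_ω` and `α < δ < ω` this is the operator `f(A)`. -/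
def contourCalc (A : X →ₗ.[ℂ] X) (δ : ℝ) (f : ℂ → ℂ) : X →L[ℂ] X :=
  (2 * (Real.pi : ℂ) * Complex.I)⁻¹ •
    ((∫ r : ℝ, f (r - δ * Complex.I) • res A (r - δ * Complex.I)) -
      ∫ r : ℝ, f (r + δ * Complex.I) • res A (r + δ * Complex.I))

/-- The operator `A` of strip type `α < ω` has a bounded `H^∞(S_ω)`-calculus: there is `C ≥ 0`
with `‖f(A)‖ ≤ C ‖f‖_∞` for all elementary `f` on `S_ω`; the contour `∂ S_δ` in the definition
of `f(A)` may be any one with `α < δ < ω`. -/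
def HasBoundedHinfCalculus (A : X →ₗ.[ℂ] X) (α ω : ℝ) : Prop :=
  ∃ C : ℝ, 0 ≤ C ∧ ∀ f : ℂ → ℂ, IsElementary ω f → ∀ δ : ℝ, α < δ → δ < ω →
    ‖contourCalc A δ f‖ ≤ C * hinfNorm ω f

end Calculus

/-! ### `γ`-radonifying operators -/

section Gamma

/-- The law of a complex standard Gaussian `γ = γ_r + i γ_i`, where `γ_r`, `γ_i` are independent
real standard Gaussians. -/
def complexStdGaussian : Measure ℂ :=
  ((gaussianReal 0 1).prod (gaussianReal 0 1)).map
    (fun p : ℝ × ℝ => (p.1 : ℂ) + (p.2 : ℂ) * Complex.I)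

variable {H : Type*} [NormedAddCommGroup H] [InnerProductSpace ℂ H]
variable {X : Type*} [NormedAddCommGroup X] [NormedSpace ℂ X]

/-- `(𝔼 ‖∑ᵢ γᵢ xᵢ‖²)^{1/2}` for independent complex standard Gaussians `γᵢ`. -/
def gaussianSumNorm {n : ℕ} (x : Fin n → X) : ℝ≥0∞ :=
  (∫⁻ g : Fin n → ℂ, ‖∑ i, g i • x i‖ₑ ^ 2 ∂(Measure.pi fun _ => complexStdGaussian)) ^ (1 / 2 : ℝ)

/-- The `γ`-norm of an operator: the supremum of the Gaussian sums over all finite orthonormal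
systems. -/
def gammaNorm (T : H →L[ℂ] X) : ℝ≥0∞ :=
  ⨆ (n : ℕ) (e : Fin n → H) (_ : Orthonormal ℂ e), gaussianSumNorm fun i => T (e i)

/-- `T ∈ γ(H; X)`: `T` is `γ`-summing and a limit in `γ`-norm of finite rank operators. -/
def IsGammaRadonifying (T : H →L[ℂ] X) : Prop :=
  gammaNorm T < ⊤ ∧ ∀ ε : ℝ≥0∞, 0 < ε →
    ∃ S : H →L[ℂ] X, FiniteDimensional ℂ (LinearMap.range (S : H →ₗ[ℂ] X)) ∧ gammaNorm (T - S) < ε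

variable {Ω : Type*} [MeasurableSpace Ω]

/-- `f` is strongly measurable and weakly `L²`. -/
def IsWeaklyL2 (f : Ω → X) (μ : Measure Ω) : Prop :=
  AEStronglyMeasurable f μ ∧ ∀ φ : X →L[ℂ] ℂ, MemLp (fun t => φ (f t)) 2 μ

/-- `T h` is the Pettis integral of `h f` for every `h ∈ L²`. -/
def IsPettisOperator (f : Ω → X) (μ : Measure Ω) (T : Lp ℂ 2 μ →L[ℂ] X) : Prop :=
  ∀ (h : Lp ℂ 2 μ) (φ : X →L[ℂ] ℂ), φ (T h) = ∫ t, h t * φ (f t) ∂μ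

theorem IsPettisOperator.unique {f : Ω → X} {μ : Measure Ω} {S T : Lp ℂ 2 μ →L[ℂ] X}
    (hS : IsPettisOperator f μ S) (hT : IsPettisOperator f μ T) : S = T := by
  ext h
  refine (SeparatingDual.eq_iff_forall_dual_eq (R := ℂ)).2 fun φ => ?_
  rw [hS h φ, hT h φ]

open Classical in
/-- The integration operator `L²(μ) → X`, `h ↦ ∫ h f dμ` (Pettis integral) of a weakly `L²`
function, if it exists (and `0` otherwise). -/
def pettisOperator (f : Ω → X) (μ : Measure Ω) : Lp ℂ 2 μ →L[ℂ] X :=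
  if h : ∃ T : Lp ℂ 2 μ →L[ℂ] X, IsPettisOperator f μ T then h.choose else 0

theorem pettisOperator_spec {f : Ω → X} {μ : Measure Ω}
    (h : ∃ T : Lp ℂ 2 μ →L[ℂ] X, IsPettisOperator f μ T) :
    IsPettisOperator f μ (pettisOperator f μ) := by
  rw [pettisOperator, dif_pos h]
  exact h.choose_spec

/-- `f ∈ γ(Ω; X)`: `f` is weakly `L²` and its integration operator is `γ`-radonifying. -/
def MemGamma (f : Ω → X) (μ : Measure Ω) : Prop :=
  IsWeaklyL2 f μ ∧ (∃ T : Lp ℂ 2 μ →L[ℂ] X, IsPettisOperator f μ T) ∧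
    IsGammaRadonifying (pettisOperator f μ)

/-- The norm `‖f‖_γ` of `f ∈ γ(Ω; X)`. -/
def gammaFunNorm (f : Ω → X) (μ : Measure Ω) : ℝ≥0∞ := gammaNorm (pettisOperator f μ)

end Gamma

/-- Arc length measure on `Γ_ω = ∂ S_ω = (iω + ℝ) ∪ (-iω + ℝ)`, `ω > 0`, as a measure on `ℂ`. -/
def stripBoundaryMeasure (ω : ℝ) : Measure ℂ :=
  (volume : Measure ℝ).map (fun s : ℝ => (s : ℂ) + ω * Complex.I) +
    (volume : Measure ℝ).map (fun s : ℝ => (s : ℂ) - ω * Complex.I)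

end

end StripCalculus

/-!
For `F` holomorphic and decaying on a strip larger than `S_ω`, the resolvent identity and Cauchy's
theorem exhibit `l ↦ R(l, A) F(A) x`, for `l` outside the closure of `S_ω`, as the Cauchy transform
of `F · R(·, A) x` along `Γ_ω`. Between horizontal lines the Cauchy transform is a Fourier
multiplier: `u ↦ (u + ia)⁻¹` is up to a constant the Fourier transform of a one-sided exponential,
which is bounded uniformly in `a ≠ 0`. On the level of test functions, `R(·, A) F(A) x` is therefore
the composition of `R(·, A) x` with operators on `L²` whose norms are at most `4 ‖F‖_∞`, uniformly
as `l` approaches `Γ_ω`. The ideal property and the Fatou property of the `γ`-norm give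
`‖R(·, A) F(A) x‖_γ ≤ 4 ‖F‖_∞ ‖R(·, A) x‖_γ`, and the two-sided square function estimate turns this
into `‖F(A)‖ ≤ (4 C / c) ‖F‖_∞`. A general `f` is the limit as `ε → 0⁺` of the functions
`z ↦ f(w) exp(-ε w²)`, `w = z / (1 + ε)`, which are defined beyond `S_ω`.
-/

namespace StripCalculus

noncomputable section

section Gaussian

open Filter Topology

attribute [local instance] InnerProductSpace.complexToReal

theorem enorm_sq_le_lintegral_of_map_neg_eq {E X : Type*} [NormedAddCommGroup E]
    [NormedSpace ℝ E] [MeasurableSpace E] [BorelSpace E] [NormedAddCommGroup X] [NormedSpace ℝ X]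
    {ν : Measure E} [IsProbabilityMeasure ν] (hν : ν.map (fun w => -w) = ν) (Φ : E →L[ℝ] X)
    (u : E) :
    ‖Φ u‖ₑ ^ 2 ≤ ∫⁻ v, ‖Φ (u + v)‖ₑ ^ 2 ∂ν := by
  have hmeas : Measurable fun v : E => ‖Φ (u + v)‖ₑ ^ 2 := Continuous.measurable (by fun_prop)
  have hsymm : ∫⁻ v, ‖Φ (u - v)‖ₑ ^ 2 ∂ν = ∫⁻ v, ‖Φ (u + v)‖ₑ ^ 2 ∂ν := by
    conv_rhs => rw [← hν, lintegral_map hmeas measurable_neg]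
    simp only [sub_eq_add_neg]
  have hconvex (v : E) : 2 * ‖Φ u‖ₑ ^ 2 ≤ ‖Φ (u + v)‖ₑ ^ 2 + ‖Φ (u - v)‖ₑ ^ 2 := by
    have hmid : (2 : ℝ) • Φ u = Φ (u + v) + Φ (u - v) := by
      rw [map_add, map_sub, two_smul]
      abel
    have hnorm : 2 * ‖Φ u‖ ≤ ‖Φ (u + v)‖ + ‖Φ (u - v)‖ := by
      calc 2 * ‖Φ u‖ = ‖Φ (u + v) + Φ (u - v)‖ := by rw [← hmid, norm_smul, Real.norm_two]
        _ ≤ ‖Φ (u + v)‖ + ‖Φ (u - v)‖ := norm_add_le _ _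
    have hsq : 2 * ‖Φ u‖ ^ 2 ≤ ‖Φ (u + v)‖ ^ 2 + ‖Φ (u - v)‖ ^ 2 := by
      nlinarith [norm_nonneg (Φ u), sq_nonneg (‖Φ (u + v)‖ - ‖Φ (u - v)‖)]
    have := ENNReal.ofReal_le_ofReal hsq
    rw [ENNReal.ofReal_mul (by norm_num), ENNReal.ofReal_add (by positivity) (by positivity)]
      at this
    simpa [ENNReal.ofReal_pow, ofReal_norm] using this
  have htwo : 2 * ‖Φ u‖ₑ ^ 2 ≤ 2 * ∫⁻ v, ‖Φ (u + v)‖ₑ ^ 2 ∂ν :=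
    calc 2 * ‖Φ u‖ₑ ^ 2 = ∫⁻ _, 2 * ‖Φ u‖ₑ ^ 2 ∂ν := by simp
      _ ≤ ∫⁻ v, (‖Φ (u + v)‖ₑ ^ 2 + ‖Φ (u - v)‖ₑ ^ 2) ∂ν := lintegral_mono hconvex
      _ = 2 * ∫⁻ v, ‖Φ (u + v)‖ₑ ^ 2 ∂ν := by rw [lintegral_add_left hmeas, hsymm, two_mul]
  exact (ENNReal.mul_le_mul_iff_right (by norm_num) (by norm_num)).1 htwo

section Domination

variable {E F X : Type*}
  [NormedAddCommGroup E] [InnerProductSpace ℂ E] [FiniteDimensional ℂ E]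
  [NormedAddCommGroup F] [InnerProductSpace ℂ F] [FiniteDimensional ℂ F]
  [NormedAddCommGroup X] [NormedSpace ℝ X]

open scoped ComplexOrder in
theorem exists_norm_adjoint_sq_add_norm_adjoint_sq (L : E →L[ℂ] F) {K : ℝ} (hL : ‖L‖ ≤ K) :
    ∃ B : F →L[ℂ] F, ∀ w : F, ‖L.adjoint w‖ ^ 2 + ‖B.adjoint w‖ ^ 2 = ‖K • w‖ ^ 2 := by
  have hinner (w : F) : inner ℂ (((K ^ 2 : ℂ) • 1 - L ∘L L.adjoint) w) w =
      ((‖K • w‖ ^ 2 - ‖L.adjoint w‖ ^ 2 : ℝ) : ℂ) := by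
    have h₁ : inner ℂ (L (L.adjoint w)) w = ((‖L.adjoint w‖ ^ 2 : ℝ) : ℂ) := by
      rw [← L.adjoint_inner_right, inner_self_eq_norm_sq_to_K]
      simp
    have h₂ : inner ℂ ((K ^ 2 : ℂ) • w) w = ((‖K • w‖ ^ 2 : ℝ) : ℂ) := by
      rw [inner_smul_left, inner_self_eq_norm_sq_to_K, norm_smul, mul_pow, Real.norm_eq_abs,
        sq_abs]
      simp
    rw [Complex.ofReal_sub, ← h₁, ← h₂, ← inner_sub_left]
    rfl
  have hpos : (0 : F →L[ℂ] F) ≤ (K ^ 2 : ℂ) • 1 - L ∘L L.adjoint := by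
    rw [ContinuousLinearMap.nonneg_iff_isPositive, ContinuousLinearMap.isPositive_iff_complex]
    intro w
    rw [hinner w]
    have hle : ‖L.adjoint w‖ ≤ ‖K • w‖ :=
      calc ‖L.adjoint w‖ ≤ ‖L.adjoint‖ * ‖w‖ := L.adjoint.le_opNorm w
        _ ≤ K * ‖w‖ := by rw [LinearIsometryEquiv.norm_map]; gcongr
        _ ≤ ‖K • w‖ := by rw [norm_smul]; gcongr; exact le_abs_self K
    exact ⟨rfl, sub_nonneg.2 (by gcongr : ‖L.adjoint w‖ ^ 2 ≤ ‖K • w‖ ^ 2)⟩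
  obtain ⟨B, hB⟩ := CStarAlgebra.nonneg_iff_eq_mul_star_self.mp hpos
  refine ⟨B, fun w => ?_⟩
  have h := hinner w
  rw [hB] at h
  have hB' : inner ℂ ((B * star B) w) w = ((‖B.adjoint w‖ ^ 2 : ℝ) : ℂ) := by
    rw [mul_apply_eq_comp, ← B.adjoint_inner_right,
      ContinuousLinearMap.star_eq_adjoint, inner_self_eq_norm_sq_to_K]
    simp
  rw [hB'] at h
  have := Complex.ofReal_injective h
  linarith

variable [MeasurableSpace E] [BorelSpace E] [MeasurableSpace F] [BorelSpace F]

theorem charFun_map_stdGaussian (L : E →L[ℂ] F) (w : F) :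
    charFun ((stdGaussian E).map L) w = Complex.exp (-‖L.adjoint w‖ ^ 2 / 2) := by
  rw [← charFun_stdGaussian, charFun_apply, charFun_apply,
    integral_map (by fun_prop) (by fun_prop)]
  simp only [real_inner_eq_re_inner ℂ, L.adjoint_inner_right]

theorem map_stdGaussian_conv_eq {L : E →L[ℂ] F} {B : F →L[ℂ] F} {K : ℝ}
    (h : ∀ w : F, ‖L.adjoint w‖ ^ 2 + ‖B.adjoint w‖ ^ 2 = ‖K • w‖ ^ 2) :
    ((stdGaussian E).map L).conv ((stdGaussian F).map B) = (stdGaussian F).map (K • ·) := by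
  have := Measure.isProbabilityMeasure_map (μ := stdGaussian E) L.measurable.aemeasurable
  have := Measure.isProbabilityMeasure_map (μ := stdGaussian F) B.measurable.aemeasurable
  have := Measure.isProbabilityMeasure_map (μ := stdGaussian F)
    (measurable_const_smul K).aemeasurable
  refine Measure.ext_of_charFun (funext fun w => ?_)
  rw [charFun_conv, charFun_map_stdGaussian, charFun_map_stdGaussian, charFun_map_smul,
    charFun_stdGaussian, ← Complex.exp_add]
  congr 1
  rw [← Complex.ofReal_pow, ← Complex.ofReal_pow, ← Complex.ofReal_pow, ← h w]
  push_cast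
  ring

theorem map_neg_map_stdGaussian (B : E →L[ℂ] F) :
    ((stdGaussian E).map B).map (fun w => -w) = (stdGaussian E).map B := by
  have hneg : ((stdGaussian E).map B).map (fun w => -w) = (stdGaussian E).map ⇑(-B) :=
    Measure.map_map measurable_neg B.measurable
  have := Measure.isProbabilityMeasure_map (μ := stdGaussian E) B.measurable.aemeasurable
  have := Measure.isProbabilityMeasure_map (μ := stdGaussian E) (-B).measurable.aemeasurable
  rw [hneg]
  refine Measure.ext_of_charFun (funext fun w => ?_)
  rw [charFun_map_stdGaussian, charFun_map_stdGaussian, map_neg, neg_apply, norm_neg]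

/-- `K γ` is distributed as `L γ` plus an independent symmetric Gaussian vector, and adding
independent symmetric noise only increases the second moment. -/
theorem lintegral_stdGaussian_comp_le (L : E →L[ℂ] F) {K : ℝ} (hL : ‖L‖ ≤ K) (Φ : F →L[ℝ] X) :
    ∫⁻ v, ‖Φ (L v)‖ₑ ^ 2 ∂stdGaussian E ≤
      ENNReal.ofReal K ^ 2 * ∫⁻ w, ‖Φ w‖ₑ ^ 2 ∂stdGaussian F := by
  obtain ⟨B, hB⟩ := exists_norm_adjoint_sq_add_norm_adjoint_sq L hL
  have hmeas : Measurable fun w : F => ‖Φ w‖ₑ ^ 2 := Continuous.measurable (by fun_prop)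
  have := Measure.isProbabilityMeasure_map (μ := stdGaussian F) B.measurable.aemeasurable
  calc ∫⁻ v, ‖Φ (L v)‖ₑ ^ 2 ∂stdGaussian E
      = ∫⁻ u, ‖Φ u‖ₑ ^ 2 ∂(stdGaussian E).map L := (lintegral_map hmeas L.measurable).symm
    _ ≤ ∫⁻ u, ∫⁻ w, ‖Φ (u + w)‖ₑ ^ 2 ∂(stdGaussian F).map B ∂(stdGaussian E).map L :=
        lintegral_mono fun u =>
          enorm_sq_le_lintegral_of_map_neg_eq (map_neg_map_stdGaussian B) Φ u
    _ = ∫⁻ w, ‖Φ (K • w)‖ₑ ^ 2 ∂stdGaussian F := by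
        rw [← Measure.lintegral_conv hmeas, map_stdGaussian_conv_eq hB,
          lintegral_map hmeas (measurable_const_smul K)]
    _ = ENNReal.ofReal K ^ 2 * ∫⁻ w, ‖Φ w‖ₑ ^ 2 ∂stdGaussian F := by
        rw [← lintegral_const_mul _ hmeas]
        simp only [map_smul, enorm_smul, mul_pow,
          Real.enorm_of_nonneg ((norm_nonneg L).trans hL)]

end Domination

variable {E X : Type*} [NormedAddCommGroup X] [NormedSpace ℂ X]

theorem charFun_complexStdGaussian (t : ℂ) :
    charFun complexStdGaussian t = Complex.exp (-‖t‖ ^ 2 / 2) := by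
  have hinner (p : ℝ × ℝ) : (inner ℝ ((p.1 : ℂ) + p.2 * Complex.I) t : ℝ) =
      t.re * p.1 + t.im * p.2 := by
    simp [Complex.inner]
  have hexp (p : ℝ × ℝ) : Complex.exp (((t.re * p.1 + t.im * p.2 : ℝ) : ℂ) * Complex.I) =
      Complex.exp ((t.re : ℂ) * p.1 * Complex.I) * Complex.exp ((t.im : ℂ) * p.2 * Complex.I) := by
    rw [← Complex.exp_add]
    push_cast
    ring_nf
  rw [charFun_apply, complexStdGaussian, integral_map (by fun_prop) (by fun_prop)]
  simp_rw [hinner, hexp]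
  rw [integral_prod_mul (fun x : ℝ => Complex.exp ((t.re : ℂ) * x * Complex.I))
    (fun x : ℝ => Complex.exp ((t.im : ℂ) * x * Complex.I)), ← charFun_apply_real,
    ← charFun_apply_real, charFun_gaussianReal, charFun_gaussianReal, ← Complex.exp_add,
    ← Complex.ofReal_pow ‖t‖, ← Complex.normSq_eq_norm_sq, Complex.normSq_apply]
  congr 1
  push_cast
  ring

instance : IsProbabilityMeasure complexStdGaussian :=
  Measure.isProbabilityMeasure_map (by fun_prop)

variable [NormedAddCommGroup E] [InnerProductSpace ℂ E] [FiniteDimensional ℂ E]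
  [MeasurableSpace E] [BorelSpace E]

theorem map_pi_complexStdGaussian {n : ℕ} (b : OrthonormalBasis (Fin n) ℂ E) :
    (Measure.pi fun _ => complexStdGaussian).map (fun g => ∑ i, g i • b i) = stdGaussian E := by
  have hmeas : Measurable fun g : Fin n → ℂ => ∑ i, g i • b i := by fun_prop
  have := Measure.isProbabilityMeasure_map (μ := Measure.pi fun _ : Fin n => complexStdGaussian)
    hmeas.aemeasurable
  refine Measure.ext_of_charFun (funext fun t => ?_)
  have hinner (i : Fin n) (z : ℂ) : (inner ℝ (z • b i) t : ℝ) = inner ℝ z (inner ℂ (b i) t) := by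
    rw [real_inner_eq_re_inner ℂ, inner_smul_left, mul_comm]
    rfl
  rw [charFun_stdGaussian, charFun_apply,
    integral_map hmeas.aemeasurable (by fun_prop)]
  simp_rw [sum_inner, Complex.ofReal_sum, Finset.sum_mul, Complex.exp_sum, hinner]
  rw [integral_fintype_prod_eq_prod
    (f := fun i z => Complex.exp ((inner ℝ z (inner ℂ (b i) t) : ℝ) * Complex.I))]
  simp_rw [← charFun_apply, charFun_complexStdGaussian]
  rw [← Complex.exp_sum, ← Finset.sum_div, Finset.sum_neg_distrib]
  simp_rw [← Complex.ofReal_pow]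
  rw [← Complex.ofReal_sum, b.sum_sq_norm_inner_right]

theorem gaussianSumNorm_orthonormalBasis {n : ℕ} (b : OrthonormalBasis (Fin n) ℂ E)
    (T : E →L[ℂ] X) :
    gaussianSumNorm (fun i => T (b i)) = (∫⁻ v, ‖T v‖ₑ ^ 2 ∂stdGaussian E) ^ (1 / 2 : ℝ) := by
  have hmeas : Measurable fun v : E => ‖T v‖ₑ ^ 2 := Continuous.measurable (by fun_prop)
  rw [gaussianSumNorm, ← map_pi_complexStdGaussian b, lintegral_map hmeas (by fun_prop)]
  simp only [map_sum, map_smul]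

variable {H H' : Type*} [NormedAddCommGroup H] [InnerProductSpace ℂ H]
  [NormedAddCommGroup H'] [InnerProductSpace ℂ H']

theorem gaussianSumNorm_le_gammaNorm (T : H →L[ℂ] X) {n : ℕ} {e : Fin n → H}
    (he : Orthonormal ℂ e) : gaussianSumNorm (fun i => T (e i)) ≤ gammaNorm T :=
  le_iSup₂_of_le n e (le_iSup_of_le he le_rfl)

theorem gammaNorm_le_iff (T : H →L[ℂ] X) (K : ℝ≥0∞) :
    gammaNorm T ≤ K ↔ ∀ (n : ℕ) (e : Fin n → H), Orthonormal ℂ e →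
      gaussianSumNorm (fun i => T (e i)) ≤ K := by
  simp only [gammaNorm, iSup_le_iff]

theorem exists_orthonormalBasis_coe_eq {ι : Type*} [Fintype ι] {e : ι → H}
    (he : Orthonormal ℂ e) :
    ∃ (V : Submodule ℂ H) (b : OrthonormalBasis ι ℂ V), ∀ i, (b i : H) = e i := by
  have horth : Orthonormal ℂ (Module.Basis.span he.linearIndependent) := by
    rw [← LinearIsometry.orthonormal_comp_iff (Submodule.subtypeₗᵢ (Submodule.span ℂ (range e)))]
    simpa [Function.comp_def, Module.Basis.span_apply] using he
  exact ⟨_, (Module.Basis.span he.linearIndependent).toOrthonormalBasis horth, by simp⟩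

theorem gammaNorm_comp_le (T : H' →L[ℂ] X) (S : H →L[ℂ] H') {K : ℝ} (hS : ‖S‖ ≤ K) :
    gammaNorm (T ∘L S) ≤ ENNReal.ofReal K * gammaNorm T := by
  refine (gammaNorm_le_iff _ _).2 fun n e he => ?_
  obtain ⟨V, b, hb⟩ := exists_orthonormalBasis_coe_eq he
  have : FiniteDimensional ℂ V := b.toBasis.finiteDimensional_of_finite
  let W : Submodule ℂ H' := V.map (S : H →ₗ[ℂ] H')
  borelize ↥V
  borelize ↥W
  let L : V →L[ℂ] W := (S ∘L V.subtypeL).codRestrict W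
    fun v => Submodule.mem_map_of_mem v.2
  have hL : ‖L‖ ≤ K := L.opNorm_le_bound ((norm_nonneg S).trans hS) fun v =>
    S.le_of_opNorm_le hS v
  let Φ : W →L[ℂ] X := T ∘L W.subtypeL
  calc gaussianSumNorm (fun i => (T ∘L S) (e i))
      = (∫⁻ v, ‖Φ (L v)‖ₑ ^ 2 ∂stdGaussian V) ^ (1 / 2 : ℝ) := by
        simp only [← hb]
        exact gaussianSumNorm_orthonormalBasis b (Φ ∘L L)
    _ ≤ (ENNReal.ofReal K ^ 2 * ∫⁻ w, ‖Φ w‖ₑ ^ 2 ∂stdGaussian W) ^ (1 / 2 : ℝ) := by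
        gcongr
        exact lintegral_stdGaussian_comp_le L hL (Φ.restrictScalars ℝ)
    _ = ENNReal.ofReal K * gaussianSumNorm (fun i => T (stdOrthonormalBasis ℂ W i)) := by
        rw [ENNReal.mul_rpow_of_nonneg _ _ (by norm_num), ← ENNReal.rpow_natCast,
          ← ENNReal.rpow_mul, ← gaussianSumNorm_orthonormalBasis (stdOrthonormalBasis ℂ W) Φ]
        norm_num [Φ]
    _ ≤ ENNReal.ofReal K * gammaNorm T := by
        gcongr
        exact gaussianSumNorm_le_gammaNorm T
          ((stdOrthonormalBasis ℂ W).orthonormal.comp_linearIsometry W.subtypeₗᵢ)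

theorem gaussianSumNorm_le_iff {n : ℕ} (x : Fin n → X) (K : ℝ≥0∞) :
    gaussianSumNorm x ≤ K ↔
      ∫⁻ g : Fin n → ℂ, ‖∑ i, g i • x i‖ₑ ^ 2 ∂(Measure.pi fun _ => complexStdGaussian) ≤
        K ^ (2 : ℝ) := by
  rw [gaussianSumNorm, ← ENNReal.rpow_le_rpow_iff (z := 2) (by norm_num), ← ENNReal.rpow_mul]
  norm_num

theorem gaussianSumNorm_le_of_tendsto {n : ℕ} {x : ℕ → Fin n → X} {y : Fin n → X} {K : ℝ≥0∞}
    (hx : ∀ i, Tendsto (fun k => x k i) atTop (𝓝 (y i)))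
    (hK : ∀ k, gaussianSumNorm (x k) ≤ K) : gaussianSumNorm y ≤ K := by
  have hlim (g : Fin n → ℂ) :
      Tendsto (fun k => ‖∑ i, g i • x k i‖ₑ ^ 2) atTop (𝓝 (‖∑ i, g i • y i‖ₑ ^ 2)) := by
    have hcont : Continuous fun w : X => ‖w‖ₑ ^ 2 := by fun_prop
    exact (hcont.tendsto _).comp (tendsto_finsetSum _ fun i _ => (hx i).const_smul (g i))
  rw [gaussianSumNorm_le_iff]
  refine (lintegral_congr fun g => (hlim g).liminf_eq.symm).trans_le ?_
  refine (lintegral_liminf_le fun k => Continuous.measurable (by fun_prop)).trans ?_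
  refine liminf_le_of_le (by isBoundedDefault) fun b hb => ?_
  obtain ⟨k, hk⟩ := hb.exists
  exact hk.trans ((gaussianSumNorm_le_iff _ _).1 (hK k))

theorem gammaNorm_le_of_tendsto {T : ℕ → H →L[ℂ] X} {S : H →L[ℂ] X} {K : ℝ≥0∞}
    (hT : ∀ h, Tendsto (fun k => T k h) atTop (𝓝 (S h))) (hK : ∀ k, gammaNorm (T k) ≤ K) :
    gammaNorm S ≤ K :=
  (gammaNorm_le_iff _ _).2 fun _ e he => gaussianSumNorm_le_of_tendsto (fun i => hT (e i))
    fun k => (gaussianSumNorm_le_gammaNorm (T k) he).trans (hK k)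

end Gaussian

section Resolvent

open Filter Topology

variable {X : Type*} [NormedAddCommGroup X] [NormedSpace ℂ X] {A : X →ₗ.[ℂ] X} {α : ℝ}

theorem res_sub_res {z w : ℂ} (hz : z ∈ resSet A) (hw : w ∈ resSet A) :
    res A z - res A w = (w - z) • (res A z).comp (res A w) := by
  ext y
  obtain ⟨hy, right_inv⟩ := (res_spec hw).1 y
  have left_inv := (res_spec hz).2 ⟨res A w y, hy⟩
  have shifted : z • res A w y - A ⟨res A w y, hy⟩ = (z - w) • res A w y + y := by
    linear_combination (norm := module) right_inv
  simp only [shifted, map_add, map_smul] at left_inv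
  simp only [sub_apply, smul_apply, ContinuousLinearMap.comp_apply]
  linear_combination (norm := module) left_inv

theorem IsStripType.mem_resSet (hA : IsStripType A α) {z : ℂ} (hz : α < |z.im|) :
    z ∈ resSet A := by
  by_contra h
  exact (hA.spectrum_subset h).not_gt hz

theorem IsStripType.exists_norm_res_le (hA : IsStripType A α) {β : ℝ} (hβ : α < β) :
    ∃ M : ℝ, 0 ≤ M ∧ ∀ z : ℂ, β ≤ |z.im| → ‖res A z‖ ≤ M := by
  obtain ⟨M, hM⟩ := hA.bounded β hβ
  exact ⟨max M 0, le_max_right _ _,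
    fun z hz => (hM z fun h => hz.not_gt h).trans (le_max_left _ _)⟩

theorem eventually_lt_abs_im {z : ℂ} {β : ℝ} (hz : β < |z.im|) : ∀ᶠ w in 𝓝 z, β < |w.im| :=
  (Complex.continuous_im.abs.tendsto z).eventually (lt_mem_nhds hz)

theorem IsStripType.continuousAt_res (hA : IsStripType A α) {z : ℂ} (hz : α < |z.im|) :
    ContinuousAt (res A) z := by
  obtain ⟨β, hβ, hβz⟩ := exists_between hz
  obtain ⟨M, hM0, hM⟩ := hA.exists_norm_res_le hβ
  rw [ContinuousAt, tendsto_iff_norm_sub_tendsto_zero]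
  have hlim : Tendsto (fun w => ‖z - w‖ * (M * M)) (𝓝 z) (𝓝 0) := by
    have : Continuous fun w : ℂ => ‖z - w‖ * (M * M) := by fun_prop
    simpa using this.tendsto z
  refine squeeze_zero' (.of_forall fun _ => norm_nonneg _) ?_ hlim
  filter_upwards [eventually_lt_abs_im hβz] with w hw
  rw [res_sub_res (hA.mem_resSet (hβ.trans hw)) (hA.mem_resSet hz), norm_smul]
  gcongr
  refine (ContinuousLinearMap.opNorm_comp_le _ _).trans ?_
  gcongr
  · exact hM w hw.le
  · exact hM z hβz.le

theorem IsStripType.hasDerivAt_res (hA : IsStripType A α) {z : ℂ} (hz : α < |z.im|) :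
    HasDerivAt (res A) (-(res A z).comp (res A z)) z := by
  rw [hasDerivAt_iff_tendsto_slope]
  have hlim : Tendsto (fun w => -(res A w).comp (res A z)) (𝓝[≠] z)
      (𝓝 (-(res A z).comp (res A z))) :=
    ((hA.continuousAt_res hz).clm_comp continuousAt_const).neg.tendsto.mono_left
      nhdsWithin_le_nhds
  refine hlim.congr' ?_
  filter_upwards [nhdsWithin_le_nhds (eventually_lt_abs_im hz), self_mem_nhdsWithin] with w hw hne
  rw [slope_def_module, res_sub_res (hA.mem_resSet hw) (hA.mem_resSet hz), smul_smul,
    ← neg_sub w z, mul_neg, inv_mul_cancel₀ (sub_ne_zero.2 hne), neg_one_smul]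

end Resolvent

section Lines

open Filter Topology

/-- The parametrization `r ↦ r + iσ` of the horizontal line at height `σ`. -/
def line (σ r : ℝ) : ℂ := r + σ * Complex.I

@[simp]
theorem line_re (σ r : ℝ) : (line σ r).re = r := by simp [line]

@[simp]
theorem line_im (σ r : ℝ) : (line σ r).im = σ := by simp [line]

theorem continuous_line (σ : ℝ) : Continuous (line σ) := by unfold line; fun_prop

variable {E : Type*} [NormedAddCommGroup E] {U V : Set ℂ} {g : ℂ → E}

/-- On `U`, the function `g` is dominated by an integrable function of `Re z` that vanishes at
infinity: the decay that makes line integrals converge and contours movable. -/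
def HasIntegrableMajorant (U : Set ℂ) (g : ℂ → E) : Prop :=
  ∃ ψ : ℝ → ℝ, Integrable ψ ∧ Tendsto ψ (cocompact ℝ) (𝓝 0) ∧ ∀ z ∈ U, ‖g z‖ ≤ ψ z.re

theorem HasIntegrableMajorant.mono (hg : HasIntegrableMajorant U g) (hVU : V ⊆ U) :
    HasIntegrableMajorant V g := by
  obtain ⟨ψ, hψ, hψ0, hle⟩ := hg
  exact ⟨ψ, hψ, hψ0, fun z hz => hle z (hVU hz)⟩

theorem HasIntegrableMajorant.integrable_line (hg : HasIntegrableMajorant U g)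
    (hc : ContinuousOn g U) {σ : ℝ} (hσ : ∀ r, line σ r ∈ U) :
    Integrable fun r => g (line σ r) := by
  obtain ⟨ψ, hψ, -, hle⟩ := hg
  refine hψ.mono' (hc.comp_continuous (continuous_line σ) hσ).aestronglyMeasurable
    (.of_forall fun r => ?_)
  simpa using hle _ (hσ r)

variable [NormedSpace ℂ E]

theorem HasIntegrableMajorant.smul_of_norm_le {f : ℂ → ℂ} (hf : HasIntegrableMajorant U f) {M : ℝ}
    (hM : ∀ z ∈ U, ‖g z‖ ≤ M) : HasIntegrableMajorant U fun z => f z • g z := by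
  obtain ⟨ψ, hψ, hψ0, hle⟩ := hf
  refine ⟨fun r => ψ r * M, hψ.mul_const M, by simpa using hψ0.mul_const M, fun z hz => ?_⟩
  rw [norm_smul]
  exact mul_le_mul (hle z hz) (hM z hz) (norm_nonneg _) ((norm_nonneg _).trans (hle z hz))

theorem tendsto_verticalIntegral {a b : ℝ}
    (hg : HasIntegrableMajorant (Complex.im ⁻¹' uIcc a b) g) {l : Filter ℝ}
    (hl : l ≤ cocompact ℝ) : Tendsto (fun r => ∫ σ in a..b, g (line σ r)) l (𝓝 0) := by
  obtain ⟨ψ, -, hψ0, hle⟩ := hg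
  have hlim : Tendsto (fun r => ψ r * |b - a|) l (𝓝 0) := by
    simpa using (hψ0.mono_left hl).mul_const |b - a|
  refine squeeze_zero_norm (fun r => ?_) hlim
  refine intervalIntegral.norm_integral_le_of_norm_le_const fun σ hσ => ?_
  simpa using hle (line σ r) (by simpa using uIoc_subset_uIcc hσ)

/-- Cauchy's theorem on the rectangles `[-T, T] × [a, b]`, as `T → ∞`. -/
theorem integral_line_eq_integral_line {a b : ℝ}
    (hd : DifferentiableOn ℂ g (Complex.im ⁻¹' uIcc a b))
    (hg : HasIntegrableMajorant (Complex.im ⁻¹' uIcc a b) g) :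
    ∫ r, g (line a r) = ∫ r, g (line b r) := by
  have horizontal : ∀ σ ∈ uIcc a b,
      Tendsto (fun T : ℝ => ∫ r in -T..T, g (line σ r)) atTop (𝓝 (∫ r, g (line σ r))) :=
    fun σ hσ => intervalIntegral_tendsto_integral
      (hg.integrable_line hd.continuousOn fun r => by simpa using hσ)
      tendsto_neg_atTop_atBot tendsto_id
  have right := tendsto_verticalIntegral hg (atTop_le_cocompact (α := ℝ))
  have left := (tendsto_verticalIntegral hg (atBot_le_cocompact (α := ℝ))).comp
    tendsto_neg_atTop_atBot
  have cauchy : ∀ T : ℝ, (((∫ r in -T..T, g (line a r)) - ∫ r in -T..T, g (line b r)) +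
      Complex.I • ∫ σ in a..b, g (line σ T)) - Complex.I • ∫ σ in a..b, g (line σ (-T)) = 0 := by
    intro T
    have := Complex.integral_boundary_rect_eq_zero_of_differentiableOn g (line a (-T)) (line b T)
      (hd.mono fun z hz => by simpa using (Complex.mem_reProdIm.1 hz).2)
    simp only [line_re, line_im] at this
    exact this
  have limit := ((horizontal a left_mem_uIcc).sub (horizontal b right_mem_uIcc)).add
    (right.const_smul Complex.I) |>.sub (left.const_smul Complex.I)
  simp only [Function.comp_def, cauchy, smul_zero, add_zero, sub_zero] at limit
  exact sub_eq_zero.1 (tendsto_nhds_unique limit tendsto_const_nhds)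

end Lines

section Contour

variable {X : Type*} [NormedAddCommGroup X] [NormedSpace ℂ X] {A : X →ₗ.[ℂ] X} {α : ℝ}
  {ω : ℝ} {F : ℂ → ℂ}

theorem contourCalc_eq_line (A : X →ₗ.[ℂ] X) (δ : ℝ) (f : ℂ → ℂ) :
    contourCalc A δ f = (2 * (Real.pi : ℂ) * Complex.I)⁻¹ •
      ((∫ r, f (line (-δ) r) • res A (line (-δ) r)) - ∫ r, f (line δ r) • res A (line δ r)) := by
  simp only [contourCalc, line, Complex.ofReal_neg, neg_mul, sub_eq_add_neg]

theorem IsStripType.continuous_res_line (hA : IsStripType A α) {σ : ℝ} (hσ : α < |σ|) :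
    Continuous fun r => res A (line σ r) :=
  continuous_iff_continuousAt.2 fun r =>
    ContinuousAt.comp (hA.continuousAt_res (by simpa using hσ)) (continuous_line σ).continuousAt

theorem IsStripType.integrable_smul_res_line (hA : IsStripType A α) {σ : ℝ} (hσ : α < |σ|)
    {f : ℝ → ℂ} (hf : Integrable f) : Integrable fun r => f r • res A (line σ r) := by
  obtain ⟨M, -, hM⟩ := hA.exists_norm_res_le hσ
  exact hf.smul_bdd M (hA.continuous_res_line hσ).aestronglyMeasurable
    (.of_forall fun r => hM _ (by simp))

theorem IsStripType.integral_line_smul_res_eq (hA : IsStripType A α)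
    (hd : DifferentiableOn ℂ F (strip ω)) (hF : HasIntegrableMajorant (strip ω) F) {a b β : ℝ}
    (hβ : α < β) (hab : ∀ σ ∈ uIcc a b, β ≤ |σ| ∧ |σ| < ω) :
    ∫ r, F (line a r) • res A (line a r) = ∫ r, F (line b r) • res A (line b r) := by
  obtain ⟨M, -, hM⟩ := hA.exists_norm_res_le hβ
  have hsub : Complex.im ⁻¹' uIcc a b ⊆ strip ω := fun z hz => (hab _ hz).2
  refine integral_line_eq_integral_line (g := fun z => F z • res A z) (fun z hz => ?_)
    ((hF.mono hsub).smul_of_norm_le fun z hz => hM z (hab _ hz).1)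
  exact (hd.mono hsub z hz).smul
    (hA.hasDerivAt_res (hβ.trans_le (hab _ hz).1)).differentiableAt.differentiableWithinAt

theorem IsStripType.contourCalc_eq_of_le (hA : IsStripType A α)
    (hd : DifferentiableOn ℂ F (strip ω)) (hF : HasIntegrableMajorant (strip ω) F) {δ ε : ℝ}
    (hδ : α < δ) (hδε : δ ≤ ε) (hε : ε < ω) : contourCalc A δ F = contourCalc A ε F := by
  have hδ0 : 0 < δ := hA.nonneg.trans_lt hδ
  have bounds : ∀ σ ∈ uIcc δ ε, δ ≤ |σ| ∧ |σ| < ω := fun σ hσ => by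
    rw [uIcc_of_le hδε] at hσ
    rw [abs_of_pos (hδ0.trans_le hσ.1)]
    exact ⟨hσ.1, hσ.2.trans_lt hε⟩
  rw [contourCalc_eq_line, contourCalc_eq_line, hA.integral_line_smul_res_eq hd hF hδ bounds,
    hA.integral_line_smul_res_eq (a := -δ) (b := -ε) hd hF hδ fun σ hσ => ?_]
  rw [← abs_neg]
  exact bounds _ (by simpa [mem_uIcc, neg_le, le_neg, and_comm, or_comm] using hσ)

theorem norm_inv_sub_le {l z : ℂ} {d : ℝ} (hd : 0 < d) (h : d ≤ |l.im - z.im|) :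
    ‖(l - z)⁻¹‖ ≤ d⁻¹ := by
  rw [norm_inv]
  exact inv_anti₀ hd (h.trans (by simpa using Complex.abs_im_le_norm (l - z)))

theorem IsStripType.res_comp_integral_line [CompleteSpace X] (hA : IsStripType A α) {l : ℂ}
    (hl : α < |l.im|) {σ : ℝ} (hσ : α < |σ|) (hlσ : l.im ≠ σ) {f : ℝ → ℂ} (hf : Integrable f) :
    (res A l).comp (∫ r, f r • res A (line σ r)) =
      (∫ r, (f r * (l - line σ r)⁻¹) • res A (line σ r)) -
        (∫ r, f r * (l - line σ r)⁻¹) • res A l := by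
  have hq : Integrable fun r => f r * (l - line σ r)⁻¹ :=
    hf.mul_bdd (c := |l.im - σ|⁻¹)
      (continuous_const.sub (continuous_line σ)).measurable.inv.aestronglyMeasurable
      (.of_forall fun r => norm_inv_sub_le (abs_pos.2 (sub_ne_zero.2 hlσ)) (by simp))
  have hR := hA.integrable_smul_res_line hσ hf
  have hqR := hA.integrable_smul_res_line hσ hq
  calc (res A l).comp (∫ r, f r • res A (line σ r))
      = ∫ r, (res A l).comp (f r • res A (line σ r)) :=
        ((ContinuousLinearMap.compL ℂ X X X (res A l)).integral_comp_comm hR).symm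
    _ = ∫ r, ((f r * (l - line σ r)⁻¹) • res A (line σ r) -
          (f r * (l - line σ r)⁻¹) • res A l) := by
        congr with r : 2
        have hne : l - line σ r ≠ 0 := fun h => hlσ (by simp [sub_eq_zero.1 h])
        have resolvent := res_sub_res (hA.mem_resSet hl)
          (hA.mem_resSet (z := line σ r) (by simpa using hσ))
        rw [ContinuousLinearMap.comp_smul, ← smul_sub, ← neg_sub (res A l), resolvent, ← neg_smul,
          neg_sub, smul_smul, inv_mul_cancel_right₀ hne]
    _ = _ := by rw [integral_sub hqR (hq.smul_const _), integral_smul_const]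

/-- Integrate the resolvent identity `R(l) R(z) = (R(z) - R(l)) / (l - z)` over the contour: the
terms with `R(l)` cancel by Cauchy's theorem, as `l` lies outside the strip. -/
theorem IsStripType.res_comp_contourCalc [CompleteSpace X] (hA : IsStripType A α)
    (hd : DifferentiableOn ℂ F (strip ω)) (hF : HasIntegrableMajorant (strip ω) F) {δ : ℝ}
    (hδ : α < δ) (hδω : δ < ω) {l : ℂ} (hl : δ < |l.im|) :
    (res A l).comp (contourCalc A δ F) = contourCalc A δ fun z => F z * (l - z)⁻¹ := by
  have hδ0 : 0 < δ := hA.nonneg.trans_lt hδ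
  set U : Set ℂ := Complex.im ⁻¹' uIcc (-δ) δ
  have mem_U : ∀ {z : ℂ}, z ∈ U ↔ |z.im| ≤ δ := by
    intro z
    rw [mem_preimage, uIcc_of_le (by linarith), abs_le, mem_Icc]
  have hUω : U ⊆ strip ω := fun z hz => (mem_U.1 hz).trans_lt hδω
  have dist_im : ∀ z ∈ U, |l.im| - δ ≤ |l.im - z.im| := fun z hz => by
    linarith [mem_U.1 hz, abs_sub_abs_le_abs_sub l.im z.im]
  have hne : ∀ z ∈ U, l - z ≠ 0 := fun z hz h => by
    rw [sub_eq_zero.1 h] at hl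
    exact (mem_U.1 hz).not_gt hl
  have hdiff : DifferentiableOn ℂ (fun z => F z * (l - z)⁻¹) U :=
    (hd.mono hUω).mul (((differentiableOn_const l).sub differentiableOn_id).inv hne)
  have hcauchy : ∫ r, F (line (-δ) r) * (l - line (-δ) r)⁻¹ =
      ∫ r, F (line δ r) * (l - line δ r)⁻¹ :=
    integral_line_eq_integral_line hdiff <| (hF.mono hUω).smul_of_norm_le fun z hz =>
      norm_inv_sub_le (sub_pos.2 hl) (dist_im z hz)
  have on_line : ∀ σ : ℝ, |σ| = δ →
      (res A l).comp (∫ r, F (line σ r) • res A (line σ r)) =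
        (∫ r, (F (line σ r) * (l - line σ r)⁻¹) • res A (line σ r)) -
          (∫ r, F (line σ r) * (l - line σ r)⁻¹) • res A l := fun σ hσ =>
    hA.res_comp_integral_line (hδ.trans hl) (by rwa [hσ]) (by rintro rfl; linarith)
      (hF.integrable_line hd.continuousOn fun r => by simpa [strip, hσ] using hδω)
  rw [contourCalc_eq_line, contourCalc_eq_line, ContinuousLinearMap.comp_smul,
    ContinuousLinearMap.comp_sub, on_line (-δ) (by rw [abs_neg, abs_of_pos hδ0]),
    on_line δ (abs_of_pos hδ0), hcauchy, sub_sub_sub_cancel_right]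

end Contour

section L2Operators

open scoped InnerProductSpace
open ContinuousLinearMap (adjoint)

variable {Ω Ω' : Type*} [MeasurableSpace Ω] [MeasurableSpace Ω'] {μ : Measure Ω} {ν : Measure Ω'}

/-- Multiplication by an essentially bounded function `m`, as an operator on `L²(μ)`. -/
def mulL2 {m : Ω → ℂ} (hm : MemLp m ∞ μ) : Lp ℂ 2 μ →L[ℂ] Lp ℂ 2 μ :=
  (ContinuousLinearMap.mul ℂ ℂ).holderL μ ∞ 2 2 (hm.toLp m)

theorem coeFn_mulL2 {m : Ω → ℂ} (hm : MemLp m ∞ μ) (h : Lp ℂ 2 μ) :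
    mulL2 hm h =ᵐ[μ] fun t => m t * h t := by
  rw [mulL2, ContinuousLinearMap.holderL_apply_apply]
  filter_upwards [ContinuousLinearMap.coeFn_holder (r := 2) (ContinuousLinearMap.mul ℂ ℂ)
    (hm.toLp m) h, hm.coeFn_toLp] with t holder_t m_t
  rw [holder_t, m_t, ContinuousLinearMap.mul_apply']

theorem norm_mulL2_le {m : Ω → ℂ} (hm : MemLp m ∞ μ) {K : ℝ} (hK : 0 ≤ K)
    (hmK : ∀ t, ‖m t‖ ≤ K) : ‖mulL2 hm‖ ≤ K := by
  have norm_m : ‖hm.toLp m‖ ≤ K := by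
    rw [Lp.norm_toLp]
    exact ENNReal.toReal_le_of_le_ofReal hK
      (by simpa using eLpNormEssSup_le_of_ae_bound (.of_forall hmK))
  refine (ContinuousLinearMap.le_of_opNorm_le _ ?_ _).trans ((one_mul _).trans_le norm_m)
  exact (ContinuousLinearMap.norm_holderL_le _).trans (ContinuousLinearMap.opNorm_mul_le ℂ ℂ)

section Composition

variable {p : Ω → Ω'}

theorem memLp_comp_of_map_le (hp : Measurable p) (hle : μ.map p ≤ ν) {k : Ω' → ℂ}
    (hk : MemLp k 2 ν) : MemLp (k ∘ p) 2 μ :=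
  (hk.mono_measure hle).comp_of_map hp.aemeasurable

theorem ae_eq_comp_of_map_le (hp : Measurable p) (hle : μ.map p ≤ ν) {k l : Ω' → ℂ}
    (h : k =ᵐ[ν] l) : k ∘ p =ᵐ[μ] l ∘ p :=
  ae_eq_comp hp.aemeasurable (h.filter_mono (Measure.absolutelyContinuous_of_le hle).ae_le)

variable (hp : Measurable p) (hle : μ.map p ≤ ν)

/-- Composition with a map `p` whose image measure is dominated by `ν`, as a contraction
`L²(ν) → L²(μ)`. For `p` the embedding of a line into a contour it is the restriction to this
line, and its adjoint is the extension by zero. -/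
def compL2 : Lp ℂ 2 ν →L[ℂ] Lp ℂ 2 μ :=
  LinearMap.mkContinuous
    { toFun := fun h => (memLp_comp_of_map_le hp hle (Lp.memLp h)).toLp (h ∘ p)
      map_add' := fun g h => by
        rw [← MemLp.toLp_add]
        exact MemLp.toLp_congr _ _ (ae_eq_comp_of_map_le hp hle (Lp.coeFn_add g h))
      map_smul' := fun c h => by
        rw [RingHom.id_apply, ← MemLp.toLp_const_smul]
        exact MemLp.toLp_congr _ _ (ae_eq_comp_of_map_le hp hle (Lp.coeFn_smul c h)) }
    1 fun h => by
      rw [one_mul, LinearMap.coe_mk, AddHom.coe_mk, Lp.norm_toLp, Lp.norm_def]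
      refine ENNReal.toReal_mono (Lp.eLpNorm_ne_top h) ?_
      rw [← eLpNorm_map_measure ((Lp.aestronglyMeasurable h).mono_measure hle) hp.aemeasurable]
      exact eLpNorm_mono_measure _ hle

theorem coeFn_compL2 (h : Lp ℂ 2 ν) : compL2 hp hle h =ᵐ[μ] h ∘ p :=
  (memLp_comp_of_map_le hp hle (Lp.memLp h)).coeFn_toLp

theorem norm_compL2_le : ‖compL2 hp hle‖ ≤ 1 :=
  LinearMap.mkContinuous_norm_le _ zero_le_one _

theorem integral_adjoint_compL2_mul (g : Lp ℂ 2 μ) {k : Ω' → ℂ} (hk : MemLp k 2 ν) :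
    ∫ z, adjoint (compL2 hp hle) g z * k z ∂ν = ∫ r, g r * k (p r) ∂μ := by
  have pairing := ContinuousLinearMap.adjoint_inner_right (compL2 hp hle) (hk.star.toLp (star k)) g
  rw [L2.inner_def, L2.inner_def] at pairing
  refine Eq.trans (integral_congr_ae ?_) (pairing.trans (integral_congr_ae ?_))
  · filter_upwards [hk.star.coeFn_toLp] with z hz
    simp [hz]
  · filter_upwards [coeFn_compL2 hp hle (hk.star.toLp (star k)),
      ae_eq_comp_of_map_le hp hle hk.star.coeFn_toLp] with r comp_r star_r
    rw [comp_r, star_r]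
    simp

theorem inner_compL2_compL2 (h k : Lp ℂ 2 ν) :
    ⟪compL2 hp hle k, compL2 hp hle h⟫_ℂ = ∫ z, ⟪k z, h z⟫_ℂ ∂μ.map p := by
  rw [L2.inner_def, integral_map hp.aemeasurable
    (((L2.integrable_inner k h).mono_measure hle).aestronglyMeasurable)]
  refine integral_congr_ae ?_
  filter_upwards [coeFn_compL2 hp hle k, coeFn_compL2 hp hle h] with r hk hh
  rw [hk, hh, Function.comp_apply, Function.comp_apply]

theorem adjoint_compL2_compL2_add {q : Ω → Ω'} (hq : Measurable q) (hle' : μ.map q ≤ ν)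
    (hν : ν = μ.map p + μ.map q) (h : Lp ℂ 2 ν) :
    adjoint (compL2 hp hle) (compL2 hp hle h) + adjoint (compL2 hq hle') (compL2 hq hle' h) =
      h := by
  refine ext_inner_left ℂ fun k => ?_
  have hint := L2.integrable_inner (𝕜 := ℂ) k h
  rw [inner_add_right, ContinuousLinearMap.adjoint_inner_right,
    ContinuousLinearMap.adjoint_inner_right, inner_compL2_compL2, inner_compL2_compL2,
    ← integral_add_measure (hint.mono_measure hle) (hint.mono_measure hle'), ← hν, L2.inner_def]

variable {X : Type*} [NormedAddCommGroup X] [NormedSpace ℂ X]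

theorem IsPettisOperator.comp {u : Ω' → X} {T : Lp ℂ 2 ν →L[ℂ] X} (hT : IsPettisOperator u ν T)
    (hu : IsWeaklyL2 u ν) :
    IsPettisOperator (fun r => u (p r)) μ (T ∘L adjoint (compL2 hp hle)) := fun g φ =>
  (hT _ φ).trans (integral_adjoint_compL2_mul hp hle g (hu.2 φ))

end Composition

variable {X : Type*} [NormedAddCommGroup X] [NormedSpace ℂ X]

theorem IsPettisOperator.smul {u : Ω → X} {T : Lp ℂ 2 μ →L[ℂ] X} (hT : IsPettisOperator u μ T)
    {m : Ω → ℂ} (hm : MemLp m ∞ μ) :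
    IsPettisOperator (fun t => m t • u t) μ (T ∘L mulL2 hm) := fun h φ => by
  rw [ContinuousLinearMap.comp_apply, hT]
  refine integral_congr_ae ?_
  filter_upwards [coeFn_mulL2 hm h] with t ht
  rw [ht, map_smul, smul_eq_mul, mul_left_comm, mul_assoc]

theorem IsPettisOperator.apply_toLp {u : Ω → X} [CompleteSpace X] {T : Lp ℂ 2 μ →L[ℂ] X}
    (hT : IsPettisOperator u μ T) {g : Ω → ℂ} (hg : MemLp g 2 μ)
    (hgu : Integrable (fun t => g t • u t) μ) : T (hg.toLp g) = ∫ t, g t • u t ∂μ := by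
  refine (SeparatingDual.eq_iff_forall_dual_eq (R := ℂ)).2 fun φ => ?_
  rw [hT, ← φ.integral_comp_comm hgu]
  refine integral_congr_ae ?_
  filter_upwards [hg.coeFn_toLp] with t ht
  rw [ht, map_smul, smul_eq_mul]

end L2Operators

section FourierMultipliers

open scoped FourierTransform SchwartzMap

variable {V : Type*} [NormedAddCommGroup V] [InnerProductSpace ℝ V] [FiniteDimensional ℝ V]
  [MeasurableSpace V] [BorelSpace V]

theorem fourier_toLp_ae_eq {E : Type*} [NormedAddCommGroup E] [InnerProductSpace ℂ E]
    [CompleteSpace E] {f : V → E} (hf : Integrable f) (hf₂ : MemLp f 2) :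
    (𝓕 (hf₂.toLp f) : Lp E 2 (volume : Measure V)) =ᵐ[volume] 𝓕 f := by
  have hcont : Continuous (𝓕 f) :=
    VectorFourier.fourierIntegral_continuous Real.continuous_fourierChar
      (by exact continuous_inner) hf
  refine ae_eq_of_integral_contDiff_smul_eq ((Lp.memLp _).locallyIntegrable (by norm_num))
    hcont.locallyIntegrable fun g hg hg_supp => ?_
  have hgℂ_supp : HasCompactSupport (Complex.ofRealCLM ∘ g) := hg_supp.comp_left rfl
  have hgℂ : ContDiff ℝ ((⊤ : ℕ∞) : WithTop ℕ∞) (Complex.ofRealCLM ∘ g) := by fun_prop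
  let φ : 𝓢(V, ℂ) := hgℂ_supp.toSchwartzMap hgℂ
  have on_L2 : ∫ x, φ x • (𝓕 (hf₂.toLp f) : Lp E 2 (volume : Measure V)) x =
      ∫ x, 𝓕 φ x • hf₂.toLp f x := by
    have := DFunLike.congr_fun (Lp.fourier_toTemperedDistribution_eq (hf₂.toLp f)) φ
    simpa only [TemperedDistribution.fourier_apply, Lp.toTemperedDistribution_apply] using this.symm
  have on_L1 : ∫ x, φ x • 𝓕 f x = ∫ x, 𝓕 φ x • f x := by
    have := VectorFourier.integral_fourierIntegral_smul_eq_flip (L := innerₗ V)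
      Real.continuous_fourierChar continuous_inner (φ.integrable (μ := volume)) hf
    rw [flip_innerₗ] at this
    rw [SchwartzMap.fourier_coe]
    exact this.symm
  have toLp_f : ∫ x, 𝓕 φ x • hf₂.toLp f x = ∫ x, 𝓕 φ x • f x :=
    integral_congr_ae (hf₂.coeFn_toLp.mono fun x hx => by simp only [hx])
  have φ_smul : ∀ x (y : E), φ x • y = g x • y := fun x y => Complex.coe_smul (g x) y
  simpa only [φ_smul] using (on_L2.trans toLp_f).trans on_L1.symm

theorem fourierInv_char_smul {E : Type*} [NormedAddCommGroup E] [NormedSpace ℂ E] (f : V → E)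
    (s r : V) : 𝓕⁻ (fun t => Real.fourierChar (-inner ℝ t s) • f t) r = 𝓕⁻ f (r - s) := by
  simp only [Real.fourierInv_eq, smul_smul, ← AddChar.map_add_eq_mul, inner_sub_right,
    ← sub_eq_add_neg]

theorem fourier_mul_fourierInv {m g : V → ℂ} (hm : Integrable m) (hg : Integrable g) (s : V) :
    𝓕 (fun t => m t * 𝓕⁻ g t) s = ∫ r, g r * 𝓕⁻ m (r - s) := by
  let mₛ : V → ℂ := fun t => Real.fourierChar (-inner ℝ t s) • m t
  have hmₛ : Integrable mₛ := (Real.fourierIntegral_convergent_iff s).2 hm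
  calc 𝓕 (fun t => m t * 𝓕⁻ g t) s = ∫ t, 𝓕⁻ g t • mₛ t := by
        rw [Real.fourier_eq]
        congr with t : 2
        rw [smul_eq_mul, mul_smul_comm, mul_comm]
    _ = ∫ r, g r • 𝓕⁻ mₛ r := by
        have flip : (-innerₗ V).flip = -innerₗ V := by
          ext x y
          simp [real_inner_comm]
        have := VectorFourier.integral_fourierIntegral_smul_eq_flip (L := -innerₗ V)
          Real.continuous_fourierChar continuous_inner.neg hg hmₛ
        rwa [flip] at this
    _ = ∫ r, g r * 𝓕⁻ m (r - s) := by simp only [mₛ, fourierInv_char_smul, smul_eq_mul]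

/-- The Fourier multiplier operator `𝓕 ∘ m ∘ 𝓕⁻¹` on `L²`. With this order of the transforms its
kernel is `k (r, s) = 𝓕⁻ m (r - s)`. -/
def multiplierL2 {m : V → ℂ} (hm : MemLp m ∞ volume) :
    Lp ℂ 2 (volume : Measure V) →L[ℂ] Lp ℂ 2 (volume : Measure V) :=
  (Lp.fourierTransformₗᵢ V ℂ : Lp ℂ 2 (volume : Measure V) →L[ℂ] Lp ℂ 2 volume) ∘L mulL2 hm ∘L
    ((Lp.fourierTransformₗᵢ V ℂ).symm : Lp ℂ 2 (volume : Measure V) →L[ℂ] Lp ℂ 2 volume)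

theorem norm_multiplierL2_le {m : V → ℂ} (hm : MemLp m ∞ volume) {K : ℝ} (hK : 0 ≤ K)
    (hmK : ∀ t, ‖m t‖ ≤ K) : ‖multiplierL2 hm‖ ≤ K := by
  refine ContinuousLinearMap.opNorm_le_bound _ hK fun h => ?_
  have := (mulL2 hm).le_of_opNorm_le (norm_mulL2_le hm hK hmK) ((Lp.fourierTransformₗᵢ V ℂ).symm h)
  simpa [multiplierL2] using this

theorem multiplierL2_toLp_ae_eq {m : V → ℂ} (hm : MemLp m ∞ volume) (hm₁ : Integrable m)
    (g : 𝓢(V, ℂ)) :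
    multiplierL2 hm (g.toLp 2) =ᵐ[volume] fun s => ∫ r, g r * 𝓕⁻ m (r - s) := by
  have hG₁ : Integrable (𝓕⁻ g : 𝓢(V, ℂ)) := SchwartzMap.integrable _
  have hmG : mulL2 hm ((𝓕⁻ g).toLp 2) =ᵐ[volume] fun t => m t * 𝓕⁻ g t := by
    filter_upwards [coeFn_mulL2 hm ((𝓕⁻ g).toLp 2), (𝓕⁻ g).coeFn_toLp 2 volume] with t hm_t hg_t
    rw [hm_t, hg_t]
  have hmG₂ : MemLp (fun t => m t * 𝓕⁻ g t) 2 volume := (memLp_congr_ae hmG).1 (Lp.memLp _)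
  have hmG₁ : Integrable fun t => m t * 𝓕⁻ g t := hG₁.mul_of_top_right hm
  have formula : multiplierL2 hm (g.toLp 2) = 𝓕 (mulL2 hm (𝓕⁻ (g.toLp 2))) := rfl
  rw [formula, SchwartzMap.toLp_fourierInv_eq, Lp.ext (hmG.trans hmG₂.coeFn_toLp.symm)]
  refine (fourier_toLp_ae_eq hmG₁ hmG₂).trans (.of_forall fun s => ?_)
  rw [SchwartzMap.fourierInv_coe]
  exact fourier_mul_fourierInv hm₁ g.integrable s

variable {X : Type*} [NormedAddCommGroup X] [NormedSpace ℂ X]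

theorem integrable_prod_smul_fourierInv {m g : V → ℂ} {v : V → X} (hm : Integrable m)
    (hg : Integrable g) (hv : Integrable v) :
    Integrable fun p : V × V => (g p.1 * 𝓕⁻ m (p.1 - p.2)) • v p.2 := by
  have hcont : Continuous (𝓕⁻ m) :=
    VectorFourier.fourierIntegral_continuous Real.continuous_fourierChar
      (by exact continuous_inner.neg) hm
  have hbdd : ∀ x, ‖𝓕⁻ m x‖ ≤ ∫ t, ‖m t‖ :=
    VectorFourier.norm_fourierIntegral_le_integral_norm _ _ (-innerₗ V) m
  refine ((hg.smul_prod hv).bdd_smul (φ := fun p => 𝓕⁻ m (p.1 - p.2)) (∫ t, ‖m t‖)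
    (by fun_prop) (.of_forall fun _ => hbdd _)).congr (.of_forall fun p => ?_)
  rw [Pi.smul_apply', smul_smul, mul_comm]

theorem IsPettisOperator.apply_multiplierL2 [CompleteSpace X] {v : V → X}
    {T : Lp ℂ 2 (volume : Measure V) →L[ℂ] X} (hT : IsPettisOperator v volume T)
    (hv : Integrable v) {m : V → ℂ} (hm : MemLp m ∞ volume) (hm₁ : Integrable m) (g : 𝓢(V, ℂ)) :
    T (multiplierL2 hm (g.toLp 2)) = ∫ r, g r • ∫ s, 𝓕⁻ m (r - s) • v s := by
  let G : V → ℂ := fun s => ∫ r, g r * 𝓕⁻ m (r - s)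
  have hG := multiplierL2_toLp_ae_eq hm hm₁ g
  have hG₂ : MemLp G 2 volume := (memLp_congr_ae hG).1 (Lp.memLp _)
  have hgmv := integrable_prod_smul_fourierInv hm₁ g.integrable hv
  have G_smul : ∀ s, G s • v s = ∫ r, (g r * 𝓕⁻ m (r - s)) • v s := fun s =>
    (integral_smul_const _ _).symm
  have hGv : Integrable fun s => G s • v s := by simpa only [G_smul] using hgmv.integral_prod_right
  rw [Lp.ext (hG.trans hG₂.coeFn_toLp.symm), hT.apply_toLp hG₂ hGv]
  simp only [G_smul, ← integral_smul, smul_smul]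
  exact (integral_integral_swap hgmv).symm

end FourierMultipliers

section CauchyKernel

open scoped FourierTransform

theorem exists_fourierInv_eq_inv_of_pos {a : ℝ} (ha : 0 < a) :
    ∃ m : ℝ → ℂ, Integrable m ∧ (∀ t, ‖m t‖ ≤ 2 * Real.pi) ∧
      ∀ u : ℝ, 𝓕⁻ m u = (u + a * Complex.I)⁻¹ := by
  have hπ := Real.pi_pos
  let b : ℂ := (-(2 * Real.pi * a) : ℝ)
  have hb : b.re < 0 := by simpa [b] using by positivity
  refine ⟨(Ioi 0).indicator fun t => -(2 * Real.pi * Complex.I) * Complex.exp (b * t),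
    ?_, fun t => ?_, fun u => ?_⟩
  · rw [integrable_indicator_iff measurableSet_Ioi]
    exact (integrableOn_exp_mul_complex_Ioi hb 0).const_mul _
  · rw [norm_indicator_eq_indicator_norm]
    refine indicator_apply_le' (fun ht : 0 < t => ?_) fun _ => by positivity
    have decay : ‖Complex.exp (b * t)‖ ≤ 1 := by
      rw [Complex.norm_exp, Real.exp_le_one_iff, Complex.re_mul_ofReal]
      exact mul_nonpos_of_nonpos_of_nonneg hb.le ht.le
    simpa [abs_of_pos hπ] using mul_le_mul_of_nonneg_left decay Real.two_pi_pos.le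
  · let c : ℂ := 2 * Real.pi * Complex.I * (u + a * Complex.I)
    have hc : c.re < 0 := by simpa [c, mul_assoc] using by positivity
    have char_smul_exp : ∀ t : ℝ,
        Real.fourierChar (inner ℝ t u) • Complex.exp (b * t) = Complex.exp (c * t) := fun t => by
      rw [Circle.smul_def, Real.fourierChar_apply, smul_eq_mul, ← Complex.exp_add]
      congr 1
      simp only [b, c, RCLike.inner_apply, conj_trivial, Complex.ofReal_mul, Complex.ofReal_neg,
        Complex.ofReal_ofNat]
      linear_combination (-2 * (Real.pi : ℂ) * a * t) * Complex.I_sq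
    calc _ = ∫ t in Ioi (0 : ℝ), -(2 * Real.pi * Complex.I) * Complex.exp (c * t) := by
          simp only [Real.fourierInv_eq, ← integral_indicator measurableSet_Ioi, ← char_smul_exp,
            mul_smul_comm, indicator_smul_apply]
      _ = (u + a * Complex.I)⁻¹ := by
          rw [integral_const_mul, integral_exp_mul_complex_Ioi hc, Complex.ofReal_zero, mul_zero,
            Complex.exp_zero]
          simp only [c]
          field_simp

theorem exists_fourierInv_eq_inv {a : ℝ} (ha : a ≠ 0) :
    ∃ m : ℝ → ℂ, Integrable m ∧ (∀ t, ‖m t‖ ≤ 2 * Real.pi) ∧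
      ∀ u : ℝ, 𝓕⁻ m u = (u + a * Complex.I)⁻¹ := by
  rcases ha.lt_or_gt with ha | ha
  · obtain ⟨m, hm, hm_le, hm_inv⟩ := exists_fourierInv_eq_inv_of_pos (neg_pos.2 ha)
    refine ⟨fun t => -m (-t), hm.comp_neg.neg, fun t => by simpa using hm_le (-t), fun u => ?_⟩
    have reflect : 𝓕⁻ (fun t => m (-t)) u = 𝓕⁻ m (-u) :=
      Real.fourierInv_comp_linearIsometry (LinearIsometryEquiv.neg ℝ) m u
    have neg : 𝓕⁻ (fun t => -m (-t)) u = -𝓕⁻ (fun t => m (-t)) u := by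
      simp only [Real.fourierInv_eq, smul_neg, integral_neg]
    rw [neg, reflect, hm_inv, ← inv_neg]
    push_cast
    ring_nf
  · exact exists_fourierInv_eq_inv_of_pos ha

end CauchyKernel

section CauchyTransform

open ContinuousLinearMap (adjoint)
open scoped FourierTransform SchwartzMap

theorem opNorm_comp_le_of_le {E F G : Type*} [SeminormedAddCommGroup E] [NormedSpace ℂ E]
    [SeminormedAddCommGroup F] [NormedSpace ℂ F] [SeminormedAddCommGroup G] [NormedSpace ℂ G]
    {S : F →L[ℂ] G} {T : E →L[ℂ] F} {a b : ℝ} (hS : ‖S‖ ≤ a) (hT : ‖T‖ ≤ b) : ‖S ∘L T‖ ≤ a * b :=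
  (S.opNorm_comp_le T).trans (mul_le_mul hS hT (norm_nonneg T) ((norm_nonneg S).trans hS))

theorem IsPettisOperator.exists_cauchyTransform {Ω X : Type*} [MeasurableSpace Ω]
    [NormedAddCommGroup X] [NormedSpace ℂ X] [CompleteSpace X] {ν : Measure Ω} {u : Ω → X}
    {T : Lp ℂ 2 ν →L[ℂ] X} (hT : IsPettisOperator u ν T) (hu : IsWeaklyL2 u ν) {p : ℝ → Ω}
    (hp : Measurable p) (hle : volume.map p ≤ ν) {f : ℝ → ℂ} (hf : AEStronglyMeasurable f) {N : ℝ}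
    (hN : ∀ s, ‖f s‖ ≤ N) (hfu : Integrable fun s => f s • u (p s)) {a : ℝ} (ha : a ≠ 0) :
    ∃ D : Lp ℂ 2 (volume : Measure ℝ) →L[ℂ] Lp ℂ 2 ν, ‖D‖ ≤ 2 * Real.pi * N ∧ ∀ g : 𝓢(ℝ, ℂ),
      Integrable (fun r => g r • ∫ s, ((r - s : ℝ) + a * Complex.I)⁻¹ • f s • u (p s)) ∧
        T (D (g.toLp 2)) = ∫ r, g r • ∫ s, ((r - s : ℝ) + a * Complex.I)⁻¹ • f s • u (p s) := by
  obtain ⟨m, hm₁, hm_le, hm⟩ := exists_fourierInv_eq_inv ha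
  have hm_top : MemLp m ∞ volume := memLp_top_of_bound hm₁.aestronglyMeasurable _ (.of_forall hm_le)
  have hf_top : MemLp f ∞ volume := memLp_top_of_bound hf _ (.of_forall hN)
  have hN0 : 0 ≤ N := (norm_nonneg _).trans (hN 0)
  simp only [← hm]
  refine ⟨adjoint (compL2 hp hle) ∘L mulL2 hf_top ∘L multiplierL2 hm_top, ?_, fun g => ⟨?_, ?_⟩⟩
  · have norm_E : ‖adjoint (compL2 hp hle)‖ ≤ 1 := by
      rw [LinearIsometryEquiv.norm_map]
      exact norm_compL2_le hp hle
    calc _ ≤ 1 * (N * (2 * Real.pi)) :=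
          opNorm_comp_le_of_le norm_E (opNorm_comp_le_of_le (norm_mulL2_le hf_top hN0 hN)
            (norm_multiplierL2_le hm_top Real.two_pi_pos.le hm_le))
      _ = 2 * Real.pi * N := by ring
  · have := (integrable_prod_smul_fourierInv hm₁ g.integrable hfu).integral_prod_left
    simpa only [mul_smul, integral_smul] using this
  · exact ((hT.comp hp hle hu).smul hf_top).apply_multiplierL2 hfu hm_top hm₁ g

end CauchyTransform

section Boundary

open ContinuousLinearMap (adjoint)

variable {ω σ : ℝ}

theorem stripBoundaryMeasure_eq_add (ω : ℝ) :
    stripBoundaryMeasure ω = volume.map (line ω) + volume.map (line (-ω)) := by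
  unfold stripBoundaryMeasure line
  simp only [Complex.ofReal_neg, neg_mul, sub_eq_add_neg]

theorem map_line_le (hσ : |σ| = ω) : volume.map (line σ) ≤ stripBoundaryMeasure ω := by
  rw [stripBoundaryMeasure_eq_add]
  rcases eq_or_eq_neg_of_abs_eq hσ with rfl | rfl
  · exact Measure.le_add_right le_rfl
  · exact Measure.le_add_left le_rfl

/-- Restriction of a function on `Γ_ω = ∂ S_ω` to one of the two lines `Im z = ± ω`. -/
def traceL2 (hσ : |σ| = ω) :
    Lp ℂ 2 (stripBoundaryMeasure ω) →L[ℂ] Lp ℂ 2 (volume : Measure ℝ) :=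
  compL2 (continuous_line σ).measurable (map_line_le hσ)

theorem norm_traceL2_le (hσ : |σ| = ω) : ‖traceL2 hσ‖ ≤ 1 := norm_compL2_le _ _

theorem adjoint_traceL2_add (hω : |ω| = ω) (hω' : |-ω| = ω)
    (h : Lp ℂ 2 (stripBoundaryMeasure ω)) :
    adjoint (traceL2 hω) (traceL2 hω h) + adjoint (traceL2 hω') (traceL2 hω' h) = h :=
  adjoint_compL2_compL2_add _ _ _ _ (stripBoundaryMeasure_eq_add ω) h

end Boundary

section Transference

open ContinuousLinearMap (adjoint)
open Filter Topology
open scoped SchwartzMap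

theorem tendsto_apply_of_denseRange {ι E X : Type*} [NormedAddCommGroup E] [NormedSpace ℂ E]
    [NormedAddCommGroup X] [NormedSpace ℂ X] {l : Filter ι} {T : ι → E →L[ℂ] X} {S : E →L[ℂ] X}
    {K : ℝ} (hT : ∀ k, ‖T k‖ ≤ K) {κ : Type*} {d : κ → E} (hd : DenseRange d)
    (h : ∀ i, Tendsto (fun k => T k (d i)) l (𝓝 (S (d i)))) (x : E) :
    Tendsto (fun k => T k x) l (𝓝 (S x)) := by
  have equi : Equicontinuous (DFunLike.coe ∘ T) :=
    ((NormedSpace.equicontinuous_TFAE T).out 5 1).1 (Exists.intro K hT)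
  exact hd.induction_on x (equi.isClosed_setOfPred_tendsto S.continuous) h

variable {X : Type*} [NormedAddCommGroup X] [NormedSpace ℂ X] {A : X →ₗ.[ℂ] X} {α ω ω' N : ℝ}
  {F : ℂ → ℂ}

theorem IsStripType.continuousAt_integral_smul_res_line (hA : IsStripType A α) {g : ℝ → ℂ}
    (hg : Integrable g) (y : X) {σ : ℝ} (hσ : α < |σ|) :
    ContinuousAt (fun θ => ∫ r, g r • res A (line θ r) y) σ := by
  obtain ⟨β, hαβ, hβσ⟩ := exists_between hσ
  obtain ⟨M, -, hM⟩ := hA.exists_norm_res_le hαβ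
  have near : ∀ᶠ θ in 𝓝 σ, β < |θ| := continuous_abs.continuousAt.eventually (lt_mem_nhds hβσ)
  refine tendsto_integral_filter_of_dominated_convergence (fun r => ‖g r‖ * (M * ‖y‖))
    (near.mono fun θ hθ => ?_) (near.mono fun θ hθ => .of_forall fun r => ?_)
    (hg.norm.mul_const _) (.of_forall fun r => ?_)
  · exact ((hA.integrable_smul_res_line (hαβ.trans hθ) hg).apply_continuousLinearMap
      y).aestronglyMeasurable
  · rw [norm_smul]
    gcongr
    exact (res A _).le_of_opNorm_le (hM _ (by simpa using hθ.le)) y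
  · have hline : Continuous fun θ => line θ r := by unfold line; fun_prop
    exact (((hA.continuousAt_res (z := line σ r) (by simpa using hσ)).comp
      (f := fun θ => line θ r) hline.continuousAt).clm_apply continuousAt_const).const_smul (g r)

variable [CompleteSpace X]

theorem IsStripType.res_line_contourCalc_apply (hA : IsStripType A α)
    (hd : DifferentiableOn ℂ F (strip ω')) (hF : HasIntegrableMajorant (strip ω') F) (hω : α < ω)
    (hω' : ω < ω') {θ : ℝ} (hθ : ω < |θ|) (r : ℝ) (x : X) :
    res A (line θ r) (contourCalc A ω F x) = (2 * (Real.pi : ℂ) * Complex.I)⁻¹ •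
      ((∫ s, ((r - s : ℝ) + (θ - -ω : ℝ) * Complex.I)⁻¹ •
          F (line (-ω) s) • res A (line (-ω) s) x) -
        ∫ s, ((r - s : ℝ) + (θ - ω : ℝ) * Complex.I)⁻¹ • F (line ω s) • res A (line ω s) x) := by
  have h0 : 0 < ω := hA.nonneg.trans_lt hω
  have line_sub : ∀ σ s : ℝ,
      line θ r - line σ s = ((r - s : ℝ) : ℂ) + (θ - σ : ℝ) * Complex.I := fun σ s => by
    simp only [line]
    push_cast
    ring
  have integrable : ∀ {σ : ℝ}, |σ| = ω → Integrable fun s =>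
      (F (line σ s) * (line θ r - line σ s)⁻¹) • res A (line σ s) := fun {σ} hσ => by
    refine hA.integrable_smul_res_line (hω.trans_eq hσ.symm) (Integrable.mul_bdd
      (c := (|θ| - ω)⁻¹) (hF.integrable_line hd.continuousOn fun s => ?_) ?_
      (.of_forall fun s => norm_inv_sub_le (sub_pos.2 hθ) ?_))
    · simpa [strip, hσ] using hω'
    · exact (continuous_const.sub (continuous_line σ)).measurable.inv.aestronglyMeasurable
    · simpa [hσ] using abs_sub_abs_le_abs_sub θ σ
  have apply_integral : ∀ {σ : ℝ}, |σ| = ω →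
      (∫ s, (F (line σ s) * (line θ r - line σ s)⁻¹) • res A (line σ s)) x =
        ∫ s, ((r - s : ℝ) + (θ - σ : ℝ) * Complex.I)⁻¹ • F (line σ s) • res A (line σ s) x :=
    fun {σ} hσ => by
      rw [ContinuousLinearMap.integral_apply (integrable hσ)]
      congr with s : 2
      rw [smul_apply, line_sub, smul_smul, mul_comm]
  rw [← ContinuousLinearMap.comp_apply, hA.res_comp_contourCalc hd hF hω hω' (by simpa using hθ),
    contourCalc_eq_line, smul_apply, sub_apply, apply_integral (by rw [abs_neg, abs_of_pos h0]),
    apply_integral (abs_of_pos h0)]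

theorem IsStripType.exists_transference (hA : IsStripType A α)
    (hd : DifferentiableOn ℂ F (strip ω')) (hF : HasIntegrableMajorant (strip ω') F)
    (hN : ∀ z ∈ strip ω', ‖F z‖ ≤ N) (hω : α < ω) (hω' : ω < ω') {x : X}
    (hx : IsWeaklyL2 (fun z => res A z x) (stripBoundaryMeasure ω))
    {J : Lp ℂ 2 (stripBoundaryMeasure ω) →L[ℂ] X}
    (hJ : IsPettisOperator (fun z => res A z x) (stripBoundaryMeasure ω) J) {θ : ℝ}
    (hθ : ω < |θ|) :
    ∃ D : Lp ℂ 2 (volume : Measure ℝ) →L[ℂ] Lp ℂ 2 (stripBoundaryMeasure ω), ‖D‖ ≤ 2 * N ∧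
      ∀ g : 𝓢(ℝ, ℂ), J (D (g.toLp 2)) =
        ∫ r, g r • res A (line θ r) (contourCalc A ω F x) := by
  have h0 : 0 < ω := hA.nonneg.trans_lt hω
  have mem_strip : ∀ {σ : ℝ}, |σ| = ω → ∀ s, line σ s ∈ strip ω' := fun hσ s => by
    simpa [strip, hσ] using hω'
  have integrable_F : ∀ {σ : ℝ}, |σ| = ω → Integrable fun s => F (line σ s) := fun hσ =>
    hF.integrable_line hd.continuousOn (mem_strip hσ)
  have cauchy : ∀ {σ : ℝ}, |σ| = ω → _ := fun {σ} hσ =>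
    hJ.exists_cauchyTransform hx (continuous_line σ).measurable (map_line_le hσ)
      (integrable_F hσ).aestronglyMeasurable (fun s => hN _ (mem_strip hσ s))
      ((hA.integrable_smul_res_line (hω.trans_eq hσ.symm)
        (integrable_F hσ)).apply_continuousLinearMap x)
      (a := θ - σ) (sub_ne_zero.2 fun h => hθ.ne' (h ▸ hσ))
  obtain ⟨D₁, norm_D₁, hD₁⟩ := cauchy (σ := -ω) (by rw [abs_neg, abs_of_pos h0])
  obtain ⟨D₂, norm_D₂, hD₂⟩ := cauchy (abs_of_pos h0)
  refine ⟨(2 * (Real.pi : ℂ) * Complex.I)⁻¹ • (D₁ - D₂), ?_, fun g => ?_⟩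
  · calc ‖(2 * (Real.pi : ℂ) * Complex.I)⁻¹ • (D₁ - D₂)‖
        ≤ (2 * Real.pi)⁻¹ * (2 * Real.pi * N + 2 * Real.pi * N) := by
          rw [norm_smul]
          gcongr
          · simp [abs_of_pos Real.pi_pos]
          · exact norm_sub_le_of_le norm_D₁ norm_D₂
      _ = 2 * N := by field_simp; ring
  · rw [smul_apply, sub_apply, map_smul, map_sub, (hD₁ g).2, (hD₂ g).2,
      ← integral_sub (hD₁ g).1 (hD₂ g).1, ← integral_smul]
    congr with r : 2
    rw [hA.res_line_contourCalc_apply hd hF hω hω' hθ, ← smul_sub, smul_comm]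

theorem IsStripType.exists_seq_tendsto_pettis (hA : IsStripType A α)
    (hd : DifferentiableOn ℂ F (strip ω')) (hF : HasIntegrableMajorant (strip ω') F)
    (hN : ∀ z ∈ strip ω', ‖F z‖ ≤ N) (hω : α < ω) (hω' : ω < ω')
    {x : X} (hx : IsWeaklyL2 (fun z => res A z x) (stripBoundaryMeasure ω))
    (hy : IsWeaklyL2 (fun z => res A z (contourCalc A ω F x)) (stripBoundaryMeasure ω))
    {J J' : Lp ℂ 2 (stripBoundaryMeasure ω) →L[ℂ] X}
    (hJ : IsPettisOperator (fun z => res A z x) (stripBoundaryMeasure ω) J)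
    (hJ' : IsPettisOperator (fun z => res A z (contourCalc A ω F x)) (stripBoundaryMeasure ω) J')
    {σ : ℝ} (hσ : |σ| = ω) :
    ∃ D : ℕ → Lp ℂ 2 (volume : Measure ℝ) →L[ℂ] Lp ℂ 2 (stripBoundaryMeasure ω),
      (∀ k, ‖D k‖ ≤ 2 * N) ∧
        ∀ h, Tendsto (fun k => J (D k h)) atTop (𝓝 (J' (adjoint (traceL2 hσ) h))) := by
  have h0 : 0 < ω := hA.nonneg.trans_lt hω
  let θ : ℕ → ℝ := fun k => (1 + 1 / ((k : ℝ) + 1)) * σ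
  have lt_abs_θ : ∀ k, ω < |θ k| := fun k => by
    have : 0 < 1 / ((k : ℝ) + 1) := by positivity
    rw [abs_mul, hσ, abs_of_pos (by positivity)]
    nlinarith
  have tendsto_θ : Tendsto θ atTop (𝓝 σ) := by
    simpa [θ] using (tendsto_one_div_add_atTop_nhds_zero_nat.const_add 1).mul_const σ
  choose D norm_D hD using fun k =>
    hA.exists_transference hd hF hN hω hω' hx hJ (lt_abs_θ k)
  refine ⟨D, norm_D, fun h => ?_⟩
  refine tendsto_apply_of_denseRange (T := fun k => J ∘L D k) (S := J' ∘L adjoint (traceL2 hσ))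
    (fun k => opNorm_comp_le_of_le le_rfl (norm_D k))
    (SchwartzMap.denseRange_toLpCLM (E := ℝ) (F := ℂ) (p := 2) ENNReal.ofNat_ne_top)
    (fun g => ?_) h
  have hασ : α < |σ| := hω.trans_eq hσ.symm
  have J'_apply : J' (adjoint (traceL2 hσ) (g.toLp 2)) =
      ∫ r, g r • res A (line σ r) (contourCalc A ω F x) :=
    (hJ'.comp (continuous_line σ).measurable (map_line_le hσ) hy).apply_toLp (g.memLp 2)
      ((hA.integrable_smul_res_line hασ g.integrable).apply_continuousLinearMap _)
  simp only [ContinuousLinearMap.comp_apply, SchwartzMap.toLpCLM_apply, hD, J'_apply]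
  exact (hA.continuousAt_integral_smul_res_line g.integrable _ hασ).tendsto.comp tendsto_θ

theorem IsStripType.gammaNorm_contourCalc_le (hA : IsStripType A α)
    (hd : DifferentiableOn ℂ F (strip ω')) (hF : HasIntegrableMajorant (strip ω') F)
    (hN : ∀ z ∈ strip ω', ‖F z‖ ≤ N) (hω : α < ω) (hω' : ω < ω')
    {x : X} (hx : IsWeaklyL2 (fun z => res A z x) (stripBoundaryMeasure ω))
    (hy : IsWeaklyL2 (fun z => res A z (contourCalc A ω F x)) (stripBoundaryMeasure ω))
    {J J' : Lp ℂ 2 (stripBoundaryMeasure ω) →L[ℂ] X}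
    (hJ : IsPettisOperator (fun z => res A z x) (stripBoundaryMeasure ω) J)
    (hJ' : IsPettisOperator (fun z => res A z (contourCalc A ω F x)) (stripBoundaryMeasure ω) J') :
    gammaNorm J' ≤ ENNReal.ofReal (4 * N) * gammaNorm J := by
  have h0 : 0 < ω := hA.nonneg.trans_lt hω
  have hω_abs : |ω| = ω := abs_of_pos h0
  have hω_neg : |-ω| = ω := by rw [abs_neg, hω_abs]
  obtain ⟨D₁, norm_D₁, hD₁⟩ := hA.exists_seq_tendsto_pettis hd hF hN hω hω' hx hy hJ hJ' hω_abs
  obtain ⟨D₂, norm_D₂, hD₂⟩ := hA.exists_seq_tendsto_pettis hd hF hN hω hω' hx hy hJ hJ' hω_neg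
  refine gammaNorm_le_of_tendsto
    (T := fun k => J ∘L (D₁ k ∘L traceL2 hω_abs + D₂ k ∘L traceL2 hω_neg)) (fun h => ?_)
    fun k => gammaNorm_comp_le J _ ?_
  · have lim := (hD₁ (traceL2 hω_abs h)).add (hD₂ (traceL2 hω_neg h))
    rw [← map_add, adjoint_traceL2_add] at lim
    simpa only [ContinuousLinearMap.comp_apply, add_apply, map_add] using lim
  · calc _ ≤ 2 * N * 1 + 2 * N * 1 :=
        norm_add_le_of_le (opNorm_comp_le_of_le (norm_D₁ k) (norm_traceL2_le hω_abs))
          (opNorm_comp_le_of_le (norm_D₂ k) (norm_traceL2_le hω_neg))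
      _ = 4 * N := by ring

end Transference

section Regularization

open Filter Topology

variable {α ω ε : ℝ} {f : ℂ → ℂ}

/-- The regularization `z ↦ f(w) exp(-ε w²)`, `w = z / (1 + ε)`, of a function on `S_ω`: it is
defined on the larger strip `S_{(1 + ε) ω}`, decays along horizontal lines, and tends to `f` as
`ε → 0⁺`. -/
def regularization (f : ℂ → ℂ) (ε : ℝ) (z : ℂ) : ℂ :=
  f (z / (1 + ε : ℝ)) * Complex.exp (-ε * (z / (1 + ε : ℝ)) ^ 2)

theorem regularization_smul (f : ℂ → ℂ) (hε : 0 < ε) (w : ℂ) :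
    regularization f ε ((1 + ε : ℝ) • w) = f w * Complex.exp (-ε * w ^ 2) := by
  have : ((1 + ε : ℝ) : ℂ) ≠ 0 := by exact_mod_cast (by positivity : 1 + ε ≠ 0)
  rw [regularization, Complex.real_smul, mul_div_cancel_left₀ _ this]

theorem norm_cexp_neg_mul_complex_sq (ε : ℝ) (w : ℂ) :
    ‖Complex.exp (-ε * w ^ 2)‖ = Real.exp (ε * w.im ^ 2) * Real.exp (-ε * w.re ^ 2) := by
  rw [Complex.norm_exp, ← Real.exp_add]
  congr 1
  simp [sq]
  ring

theorem div_mem_strip {s : ℝ} (hs : 0 < s) {z : ℂ} (hz : z ∈ strip (s * ω)) :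
    z / s ∈ strip ω := by
  simp only [strip, mem_ofPred_eq] at hz ⊢
  rwa [Complex.div_ofReal_im, abs_div, abs_of_pos hs, div_lt_iff₀ hs, mul_comm]

theorem IsElementary.norm_le (hf : IsElementary ω f) {z : ℂ} (hz : z ∈ strip ω) :
    ‖f z‖ ≤ hinfNorm ω f :=
  le_csSup hf.bdd ⟨z, hz, rfl⟩

theorem IsElementary.norm_regularization_le_gaussian (hf : IsElementary ω f) (hε : 0 < ε) {z : ℂ}
    (hz : z ∈ strip ((1 + ε) * ω)) :
    ‖regularization f ε z‖ ≤
      hinfNorm ω f * Real.exp (ε * ω ^ 2) * Real.exp (-ε * (z.re / (1 + ε)) ^ 2) := by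
  have hw : z / (1 + ε : ℝ) ∈ strip ω := div_mem_strip (by positivity) hz
  have norm_f := hf.norm_le hw
  have : 0 ≤ hinfNorm ω f := (norm_nonneg _).trans norm_f
  have im_sq_le : (z / (1 + ε : ℝ)).im ^ 2 ≤ ω ^ 2 := sq_le_sq.2 (hw.le.trans (le_abs_self ω))
  rw [regularization, norm_mul, norm_cexp_neg_mul_complex_sq, Complex.div_ofReal_re, mul_assoc]
  gcongr

theorem IsElementary.norm_regularization_le_mul_exp (hf : IsElementary ω f) (hε : 0 < ε) {z : ℂ}
    (hz : z ∈ strip ((1 + ε) * ω)) :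
    ‖regularization f ε z‖ ≤ hinfNorm ω f * Real.exp (ε * ω ^ 2) := by
  have : 0 ≤ hinfNorm ω f :=
    (norm_nonneg _).trans (hf.norm_le (div_mem_strip (by positivity) hz))
  refine (hf.norm_regularization_le_gaussian hε hz).trans
    (mul_le_of_le_one_right (by positivity) ?_)
  rw [Real.exp_le_one_iff]
  nlinarith [sq_nonneg (z.re / (1 + ε))]

theorem IsElementary.differentiableOn_regularization (hf : IsElementary ω f) (hε : 0 < ε) :
    DifferentiableOn ℂ (regularization f ε) (strip ((1 + ε) * ω)) := by
  have dilation : DifferentiableOn ℂ (fun z : ℂ => z / (1 + ε : ℝ)) (strip ((1 + ε) * ω)) := by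
    fun_prop
  exact (hf.holo.comp dilation fun _ => div_mem_strip (by positivity)).mul (by fun_prop)

theorem IsElementary.hasIntegrableMajorant_regularization (hf : IsElementary ω f) (hε : 0 < ε) :
    HasIntegrableMajorant (strip ((1 + ε) * ω)) (regularization f ε) := by
  have h0 : 0 < 1 + ε := by positivity
  have gaussian_tendsto : Tendsto (fun r => Real.exp (-ε * r ^ 2)) (cocompact ℝ) (𝓝 0) := by
    simpa using tendsto_rpow_abs_mul_exp_neg_mul_sq_cocompact hε 0
  have dilation : Tendsto (fun r => r / (1 + ε)) (cocompact ℝ) (cocompact ℝ) := by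
    simpa only [div_eq_mul_inv, Homeomorph.coe_mulRight₀] using
      (Homeomorph.mulRight₀ _ (inv_ne_zero h0.ne')).isClosedEmbedding.tendsto_cocompact
  refine ⟨fun r => hinfNorm ω f * Real.exp (ε * ω ^ 2) * Real.exp (-ε * (r / (1 + ε)) ^ 2),
    ((integrable_exp_neg_mul_sq hε).comp_div h0.ne').const_mul _, ?_,
    fun z hz => hf.norm_regularization_le_gaussian hε hz⟩
  simpa using (gaussian_tendsto.comp dilation).const_mul (hinfNorm ω f * Real.exp (ε * ω ^ 2))

section Limit

variable {X : Type*} [NormedAddCommGroup X] [NormedSpace ℂ X] {A : X →ₗ.[ℂ] X} {K : ℝ}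

theorem integral_line_mul {E : Type*} [NormedAddCommGroup E] [NormedSpace ℝ E] (g : ℂ → E)
    {s : ℝ} (hs : 0 < s) (σ : ℝ) :
    ∫ r, g (line (s * σ) r) = s • ∫ r, g (s • line σ r) := by
  have smul_line : ∀ r, s • line σ r = line (s * σ) (s * r) := fun r => by
    simp only [line, Complex.real_smul]
    push_cast
    ring
  simp_rw [smul_line]
  rw [Measure.integral_comp_mul_left (fun r => g (line (s * σ) r)), abs_of_pos (inv_pos.2 hs),
    smul_inv_smul₀ hs.ne']

theorem norm_cexp_neg_mul_sq_le_exp_im_sq (hε : 0 ≤ ε) (hε' : ε ≤ 1) (w : ℂ) :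
    ‖Complex.exp (-ε * w ^ 2)‖ ≤ Real.exp (w.im ^ 2) := by
  rw [norm_cexp_neg_mul_complex_sq, ← Real.exp_add, Real.exp_le_exp]
  nlinarith [mul_nonneg hε (sq_nonneg w.re), mul_le_of_le_one_left (sq_nonneg w.im) hε']

theorem IsStripType.tendsto_integral_regularization (hA : IsStripType A α)
    (hf : IsElementary ω f) {σ : ℝ} (hσ : α < |σ|) (hσω : |σ| < ω) :
    Tendsto (fun ε => ∫ r, regularization f ε (line ((1 + ε) * σ) r) •
      res A (line ((1 + ε) * σ) r)) (𝓝[>] 0) (𝓝 (∫ r, f (line σ r) • res A (line σ r))) := by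
  obtain ⟨M, -, hM⟩ := hA.exists_norm_res_le hσ
  have le_abs_im : ∀ {ε : ℝ}, 0 < ε → ∀ r, |σ| ≤ |((1 + ε) • line σ r).im| := fun {ε} hε r => by
    rw [Complex.smul_im, line_im, smul_eq_mul, abs_mul, abs_of_pos (by positivity : 0 < 1 + ε)]
    exact le_mul_of_one_le_left (abs_nonneg σ) (by linarith)
  have hfσ : Integrable fun r => f (line σ r) := hf.integrable σ hσω
  have rescaled : Tendsto (fun ε : ℝ => ∫ r, (f (line σ r) * Complex.exp (-ε * line σ r ^ 2)) •
      res A ((1 + ε) • line σ r)) (𝓝[>] 0) (𝓝 (∫ r, f (line σ r) • res A (line σ r))) := by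
    refine tendsto_integral_filter_of_dominated_convergence
      (fun r => ‖f (line σ r)‖ * Real.exp (σ ^ 2) * M) ?_ ?_
      ((hfσ.norm.mul_const _).mul_const _) (.of_forall fun r => ?_)
    · filter_upwards [self_mem_nhdsWithin] with ε (hε : 0 < ε)
      have := continuous_line σ
      refine (hfσ.aestronglyMeasurable.mul (Continuous.aestronglyMeasurable (by fun_prop))).smul
        (Continuous.aestronglyMeasurable (continuous_iff_continuousAt.2 fun r => ?_))
      exact (hA.continuousAt_res (hσ.trans_le (le_abs_im hε r))).comp
        (f := fun r => (1 + ε) • line σ r) (by fun_prop)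
    · filter_upwards [Ioc_mem_nhdsGT one_pos] with ε hε
      refine .of_forall fun r => ?_
      rw [norm_smul, norm_mul]
      gcongr
      · simpa using norm_cexp_neg_mul_sq_le_exp_im_sq hε.1.le hε.2 (line σ r)
      · exact hM _ (le_abs_im hε.1 r)
    · refine Tendsto.mono_left ?_ nhdsWithin_le_nhds
      have cont_res : ContinuousAt (fun ε : ℝ => res A ((1 + ε) • line σ r)) 0 :=
        ContinuousAt.comp (f := fun ε : ℝ => (1 + ε) • line σ r)
          (hA.continuousAt_res (by simpa using hσ)) (by fun_prop)
      have cont_exp : Continuous fun ε : ℝ => f (line σ r) * Complex.exp (-ε * line σ r ^ 2) := by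
        fun_prop
      simpa using cont_exp.continuousAt.tendsto.smul cont_res.tendsto
  have scale : Tendsto (fun ε : ℝ => 1 + ε) (𝓝[>] 0) (𝓝 1) :=
    ((by fun_prop : Continuous fun ε : ℝ => 1 + ε).tendsto' 0 1 (add_zero 1)).mono_left
      nhdsWithin_le_nhds
  rw [← one_smul ℝ (∫ r, f (line σ r) • res A (line σ r))]
  refine (scale.smul rescaled).congr' ?_
  filter_upwards [self_mem_nhdsWithin] with ε (hε : 0 < ε)
  rw [integral_line_mul (fun z => regularization f ε z • res A z) (by positivity)]
  simp only [regularization_smul f hε]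

theorem IsStripType.tendsto_contourCalc_regularization (hA : IsStripType A α)
    (hf : IsElementary ω f) {δ : ℝ} (hδ : α < δ) (hδω : δ < ω) :
    Tendsto (fun ε => contourCalc A ((1 + ε) * δ) (regularization f ε)) (𝓝[>] 0)
      (𝓝 (contourCalc A δ f)) := by
  have hδ_abs : |δ| = δ := abs_of_pos (hA.nonneg.trans_lt hδ)
  simp only [contourCalc_eq_line, ← mul_neg]
  exact ((hA.tendsto_integral_regularization hf (by simpa [hδ_abs]) (by simpa [hδ_abs])).sub
    (hA.tendsto_integral_regularization hf (by simpa [hδ_abs]) (by simpa [hδ_abs]))).const_smul _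

theorem IsStripType.hasBoundedHinfCalculus_of_forall_norm_le (hA : IsStripType A α)
    (hω : α < ω) (hK : 0 ≤ K)
    (h : ∀ ω' > ω, ∀ (F : ℂ → ℂ) (N : ℝ), DifferentiableOn ℂ F (strip ω') →
      HasIntegrableMajorant (strip ω') F → (∀ z ∈ strip ω', ‖F z‖ ≤ N) →
        ‖contourCalc A ω F‖ ≤ K * N) :
    HasBoundedHinfCalculus A α ω := by
  refine ⟨K, hK, fun f hf δ hδ hδω => ?_⟩
  have hω0 : 0 < ω := hA.nonneg.trans_lt hω
  have bound_tendsto : Tendsto (fun ε => K * (hinfNorm ω f * Real.exp (ε * ω ^ 2))) (𝓝[>] 0)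
      (𝓝 (K * hinfNorm ω f)) :=
    ((by fun_prop : Continuous fun ε => K * (hinfNorm ω f * Real.exp (ε * ω ^ 2))).tendsto' 0 _
      (by simp)).mono_left nhdsWithin_le_nhds
  refine le_of_tendsto_of_tendsto (hA.tendsto_contourCalc_regularization hf hδ hδω).norm
    bound_tendsto ?_
  have near : ∀ᶠ ε : ℝ in 𝓝[>] 0, (1 + ε) * δ < ω :=
    ((by fun_prop : Continuous fun ε : ℝ => (1 + ε) * δ).tendsto' 0 δ (by simp)).mono_left
      nhdsWithin_le_nhds |>.eventually_lt_const hδω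
  filter_upwards [self_mem_nhdsWithin, near] with ε (hε : 0 < ε) hδε
  have hωε : ω < (1 + ε) * ω := by nlinarith
  have hαδ : α < (1 + ε) * δ := by nlinarith [hA.nonneg.trans_lt hδ]
  have holo := hf.differentiableOn_regularization hε
  have majorant := hf.hasIntegrableMajorant_regularization hε
  rw [hA.contourCalc_eq_of_le holo majorant hαδ hδε.le hωε]
  exact h _ hωε _ _ holo majorant fun z => hf.norm_regularization_le_mul_exp hε

end Limit

end Regularization

section SquareFunction

variable {X : Type*} [NormedAddCommGroup X] [NormedSpace ℂ X] [CompleteSpace X] {A : X →ₗ.[ℂ] X}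
  {α ω c C : ℝ}

theorem IsStripType.norm_contourCalc_le_of_gammaFunNorm (hA : IsStripType A α) (hω : α < ω)
    (hmem : ∀ x, IsWeaklyL2 (fun z => res A z x) (stripBoundaryMeasure ω))
    (hpettis : ∀ x, ∃ T : Lp ℂ 2 (stripBoundaryMeasure ω) →L[ℂ] X,
      IsPettisOperator (fun z => res A z x) (stripBoundaryMeasure ω) T)
    (hc : 0 < c) (hC : 0 ≤ C)
    (hlower : ∀ x, ENNReal.ofReal (c * ‖x‖) ≤
      gammaFunNorm (fun z => res A z x) (stripBoundaryMeasure ω))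
    (hupper : ∀ x, gammaFunNorm (fun z => res A z x) (stripBoundaryMeasure ω) ≤
      ENNReal.ofReal (C * ‖x‖))
    {ω' : ℝ} (hω' : ω < ω') {F : ℂ → ℂ} {N : ℝ} (hd : DifferentiableOn ℂ F (strip ω'))
    (hF : HasIntegrableMajorant (strip ω') F) (hN : ∀ z ∈ strip ω', ‖F z‖ ≤ N) :
    ‖contourCalc A ω F‖ ≤ 4 * C / c * N := by
  have hω'0 : 0 < ω' := (hA.nonneg.trans_lt hω).trans hω'
  have hN0 : 0 ≤ N := (norm_nonneg _).trans (hN 0 (by simpa [strip] using hω'0))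
  refine ContinuousLinearMap.opNorm_le_bound _ (by positivity) fun x => ?_
  set y := contourCalc A ω F x
  have orbit_le : ENNReal.ofReal (c * ‖y‖) ≤ ENNReal.ofReal (4 * N * (C * ‖x‖)) :=
    calc ENNReal.ofReal (c * ‖y‖)
        ≤ gammaFunNorm (fun z => res A z y) (stripBoundaryMeasure ω) := hlower y
      _ ≤ ENNReal.ofReal (4 * N) * gammaFunNorm (fun z => res A z x) (stripBoundaryMeasure ω) :=
        hA.gammaNorm_contourCalc_le hd hF hN hω hω' (hmem x) (hmem y)
          (pettisOperator_spec (hpettis x)) (pettisOperator_spec (hpettis y))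
      _ ≤ ENNReal.ofReal (4 * N) * ENNReal.ofReal (C * ‖x‖) := by
        gcongr
        exact hupper x
      _ = ENNReal.ofReal (4 * N * (C * ‖x‖)) := (ENNReal.ofReal_mul (by positivity)).symm
  rw [ENNReal.ofReal_le_ofReal_iff (by positivity), ← le_div_iff₀' hc] at orbit_le
  exact orbit_le.trans_eq (by ring)

end SquareFunction

end

end StripCalculus

open StripCalculus in
theorem mainTheorem7_general {X : Type*} [NormedAddCommGroup X] [NormedSpace ℂ X] [CompleteSpace X]
    (A : X →ₗ.[ℂ] X) (ω₀ ω : ℝ) (hA : IsStripType A ω₀) (hω : ω₀ < ω)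
    (hmem : ∀ x : X, IsWeaklyL2 (fun z => res A z x) (stripBoundaryMeasure ω) ∧
      ∃ T : Lp ℂ 2 (stripBoundaryMeasure ω) →L[ℂ] X,
        IsPettisOperator (fun z => res A z x) (stripBoundaryMeasure ω) T)
    (hequiv : ∃ c C : ℝ, 0 < c ∧ 0 < C ∧ ∀ x : X,
      ENNReal.ofReal (c * ‖x‖) ≤ gammaFunNorm (fun z => res A z x) (stripBoundaryMeasure ω) ∧
      gammaFunNorm (fun z => res A z x) (stripBoundaryMeasure ω) ≤ ENNReal.ofReal (C * ‖x‖)) :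
    HasBoundedHinfCalculus A ω₀ ω := by
  obtain ⟨c, C, hc, hC, hcC⟩ := hequiv
  refine hA.hasBoundedHinfCalculus_of_forall_norm_le hω (K := 4 * C / c) (by positivity) ?_
  intro ω' hω' F N hd hF hN
  exact hA.norm_contourCalc_le_of_gammaFunNorm hω (fun x => (hmem x).1) (fun x => (hmem x).2) hc
    hC.le (fun x => (hcC x).1) (fun x => (hcC x).2) hω' hd hF hN

open StripCalculus in
theorem mainTheorem7 {X : Type*} [NormedAddCommGroup X] [NormedSpace ℂ X] [CompleteSpace X]
    (A : X →ₗ.[ℂ] X) (hdense : Dense (A.domain : Set X))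
    (ω₀ ω : ℝ) (hA : IsStripType A ω₀) (hω : ω₀ < ω)
    (hmem : ∀ x : X, MemGamma (fun z => res A z x) (stripBoundaryMeasure ω))
    (hequiv : ∃ c C : ℝ, 0 < c ∧ 0 < C ∧ ∀ x : X,
      ENNReal.ofReal (c * ‖x‖) ≤ gammaFunNorm (fun z => res A z x) (stripBoundaryMeasure ω) ∧
      gammaFunNorm (fun z => res A z x) (stripBoundaryMeasure ω) ≤ ENNReal.ofReal (C * ‖x‖)) :
    HasBoundedHinfCalculus A ω₀ ω :=
  mainTheorem7_general A ω₀ ω hA hω (fun x => ⟨(hmem x).1, (hmem x).2.1⟩) hequiv
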